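/- Let $G=(V,E)$ be a finite connected simple graph that contains at least one circuit, let $\Delta$ be its maximum degree, let $N\ge 1$, and let $W_1,W_2:\mathbb N\to(0,\infty)$, $\mathbb N=\{0,1,2,\dots\}$. Put $W(k)=W_1(k)$ for $k>0$ and $W(k)=W_2(-k)$ for $k\le 0$. **The Ant random walk.** Let $\vec X(n)=(X_1(n),\dots,X_N(n))\in V^N$, $n\ge 0$, be the following process, with an arbitrary distribution of $\vec X(0)$. For $u\sim v$ let $$c_n(u,v)=\sum_{i=1}^N\sum_{m=1}^n\big(\mathbf 1_{\{(X_i(m-1),X_i(m))=(u,v)\}}-\mathbf 1_{\{(X_i(m-1),X_i(m))=(v,u)\}}\big)$$ be the crossing number of $(u,v)$ at time $n$. Given $\vec X(0),\dots,\vec X(n)$, an index $i\in\{1,\dots,N\}$ is chosen uniformly at random, walker $i$ jumps to a neighbour $u$ of $X_i(n)$ with probability $$\frac{W(c_n(X_i(n),u))}{\sum_{w\sim X_i(n)}W(c_n(X_i(n),w))},$$ and the other walkers do not move. **The condition (A2).** For $\phi\in\mathbb Z^d$ let $\Upsilon^+(\phi)=\sum_{i:\phi(i)>0}W_1(\phi(i))$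 and $\Upsilon^-(\phi)=\sum_{i:\phi(i)\le 0}W_2(-\phi(i))$. Let $\Phi$ be the set of all sequences $(\phi_n)_{n\ge 0}$ in $\mathbb Z^d$, for some $d\in\{1,\dots,\Delta\}$, such that for every $n\ge 0$: $-N\le\sum_{j=1}^d\phi_n(j)\le N$, and there are $j_1,j_2$ with $\phi_n(j_1)>0$, $\phi_{n+1}(j_1)=\phi_n(j_1)+1$, $\phi_n(j_2)\le 0$, $\phi_{n+1}(j_2)=\phi_n(j_2)-1$, and $\phi_{n+1}(j)=\phi_n(j)$ for all $j\notin\{j_1,j_2\}$. Assume $$\sup_{\phi\in\Phi}\ \sum_{n=0}^\infty\frac{\Upsilon^-(\phi_n)}{\Upsilon^+(\phi_n)}<\infty.\qquad\text{(A2)}$$ **Theorem.** Under (A2) the following hold. 1. Almost surely the event $\mathrm{Monot}$ occurs: there is $m\in\mathbb N$ such that for every ordered pair $(u,v)$ of adjacent vertices the map $n\mapsto c_n(u,v)$ is monotone (nondecreasing or nonincreasing) on $\{n\ge m\}$. 2. If $\Delta\ge 3$ (equivalently, if $G$ is not itself a single cycle), then $\sum_{k=0}^\infty 1/W_1(k)<\infty$.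 3. Almost surely the event $\mathrm{LocTrapp}$ occurs: $\mathrm{Monot}$ occurs, and there are $K\le N$ and pairwise vertex-disjoint circuits $C_1,\dots,C_K$ of $G$ such that the set of vertices visited infinitely often by the walkers is $\bigcup_{i=1}^K V(C_i)$ and the set of edges crossed infinitely often by the walkers (in any direction) is $\bigcup_{i=1}^K E(C_i)$. -/

import Mathlib

open MeasureTheory Filter

namespace AntRW

noncomputable section

/-- The reinforcement function on `ℤ`: `W k = W₁ k` for `k > 0` and `W k = W₂ (-k)` for `k ≤ 0`. -/
def weight (W₁ W₂ : ℕ → ℝ) (k : ℤ) : ℝ :=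
  if 0 < k then W₁ k.toNat else W₂ (-k).toNat

/-- For a trajectory `x` of `N` walkers (`x n i` is the position of walker `i` at time `n`), the
number of jumps of walker `i` from `u` to `v` minus its number of jumps from `v` to `u`, up to
time `n`. -/
def crossingOf {V : Type*} [DecidableEq V] {N : ℕ} (x : ℕ → Fin N → V) (i : Fin N) (n : ℕ)
    (u v : V) : ℤ :=
  ∑ m ∈ Finset.range n,
    ((if (x m i, x (m + 1) i) = (u, v) then 1 else 0)
      - (if (x m i, x (m + 1) i) = (v, u) then 1 else 0))

/-- The collective crossing number `c_n(u, v)`. -/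
def crossing {V : Type*} [DecidableEq V] {N : ℕ} (x : ℕ → Fin N → V) (n : ℕ) (u v : V) : ℤ :=
  ∑ i, crossingOf x i n u v

/-- Given the trajectory `x` up to time `n`, the probability that the configuration at time `n + 1`
is `y`: a walker `i` is chosen uniformly, and it jumps to a neighbour `u` of its position `x n i`
with probability proportional to `W (c_n(x n i, u))`; the other walkers do not move. -/
def stepProb {V : Type*} [Fintype V] [DecidableEq V] (G : SimpleGraph V) [DecidableRel G.Adj]
    {N : ℕ} (W₁ W₂ : ℕ → ℝ) (x : ℕ → Fin N → V) (n : ℕ) (y : Fin N → V) : ℝ :=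
  ∑ i : Fin N, (1 / (N : ℝ)) * ∑ u ∈ G.neighborFinset (x n i),
    if y = Function.update (x n) i u then
      weight W₁ W₂ (crossing x n (x n i) u)
        / ∑ w ∈ G.neighborFinset (x n i), weight W₁ W₂ (crossing x n (x n i) w)
    else 0

/-- `X` is an Ant random walk with `N` walkers on the finite graph `G`, with reinforcement functions
`W₁`, `W₂`, under the probability measure `P`: for every finite trajectory `x 0, …, x n` and every
next configuration `x (n + 1)`, conditionally on `X 0 = x 0, …, X n = x n` the probability of
`X (n + 1) = x (n + 1)` is `stepProb`. The distribution of `X 0` is arbitrary. -/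
structure IsAntRW {V : Type*} [Fintype V] [DecidableEq V] (G : SimpleGraph V) [DecidableRel G.Adj]
    {N : ℕ} (W₁ W₂ : ℕ → ℝ) {Ω : Type*} [MeasurableSpace Ω] (P : Measure Ω)
    (X : ℕ → Ω → Fin N → V) : Prop where
  measurableSet_eq : ∀ (n : ℕ) (y : Fin N → V), MeasurableSet {ω | X n ω = y}
  transition : ∀ (n : ℕ) (x : ℕ → Fin N → V),
    P.real {ω | ∀ m ≤ n + 1, X m ω = x m}
      = P.real {ω | ∀ m ≤ n, X m ω = x m} * stepProb G W₁ W₂ x n (x (n + 1))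

/-- `Υ⁺(φ)`, the sum of `W₁ (φ i)` over the positive coordinates. -/
def upsilonPos (W₁ : ℕ → ℝ) {d : ℕ} (φ : Fin d → ℤ) : ℝ :=
  ∑ i with 0 < φ i, W₁ (φ i).toNat

/-- `Υ⁻(φ)`, the sum of `W₂ (-φ i)` over the nonpositive coordinates. -/
def upsilonNeg (W₂ : ℕ → ℝ) {d : ℕ} (φ : Fin d → ℤ) : ℝ :=
  ∑ i with φ i ≤ 0, W₂ (-φ i).toNat

/-- The set `Φ` of admissible crossing-number sequences, for maximum degree `Δ` and `N` walkers; an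
element is a dimension `d` together with a sequence in `ℤ ^ d`. -/
def admissible (Δ N : ℕ) : Set (Σ d : ℕ, ℕ → Fin d → ℤ) :=
  {s | (1 ≤ s.1 ∧ s.1 ≤ Δ) ∧
    (∀ n, -(N : ℤ) ≤ ∑ j, s.2 n j ∧ ∑ j, s.2 n j ≤ (N : ℤ)) ∧
    ∀ n, ∃ j₁ j₂,
      (0 < s.2 n j₁ ∧ s.2 (n + 1) j₁ = s.2 n j₁ + 1) ∧
      (s.2 n j₂ ≤ 0 ∧ s.2 (n + 1) j₂ = s.2 n j₂ - 1) ∧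
      ∀ j, j ≠ j₁ → j ≠ j₂ → s.2 (n + 1) j = s.2 n j}

/-- The summability condition: `∑ₙ Υ⁻(φ_n) / Υ⁺(φ_n)` is bounded uniformly over admissible `φ`. -/
def SummabilityCondition (Δ N : ℕ) (W₁ W₂ : ℕ → ℝ) : Prop :=
  (⨆ s ∈ admissible Δ N,
    ∑' n, ENNReal.ofReal (upsilonNeg W₂ (s.2 n) / upsilonPos W₁ (s.2 n))) < ⊤

/-- From some time on, every crossing number is a monotone (nondecreasing or nonincreasing) function
of time. -/
def Monot {V : Type*} [DecidableEq V] (G : SimpleGraph V) {N : ℕ} (x : ℕ → Fin N → V) : Prop :=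
  ∃ m : ℕ, ∀ u v, G.Adj u v →
    MonotoneOn (fun n => crossing x n u v) (Set.Ici m) ∨
      AntitoneOn (fun n => crossing x n u v) (Set.Ici m)

/-- The vertices visited infinitely often. -/
def vertexInf {V : Type*} {N : ℕ} (x : ℕ → Fin N → V) : Set V :=
  {v | ∃ᶠ n in atTop, ∃ i, x n i = v}

/-- The edges of `G` crossed infinitely often, in any direction. -/
def edgeInf {V : Type*} (G : SimpleGraph V) {N : ℕ} (x : ℕ → Fin N → V) : Set (Sym2 V) :=
  {e | e ∈ G.edgeSet ∧ ∃ᶠ n in atTop, ∃ i, s(x n i, x (n + 1) i) = e}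

/-- The crossing numbers are eventually monotone, and there are `K ≤ N` pairwise vertex-disjoint
circuits of `G` such that the vertices visited infinitely often and the edges crossed infinitely
often are exactly the vertices and the edges of these circuits. -/
def LocTrapp {V : Type*} [DecidableEq V] (G : SimpleGraph V) {N : ℕ} (x : ℕ → Fin N → V) : Prop :=
  Monot G x ∧
  ∃ K ≤ N, ∃ (b : Fin K → V) (C : (i : Fin K) → G.Walk (b i) (b i)),
    (∀ i, (C i).IsCycle) ∧
    (∀ i j, i ≠ j → Disjoint {v | v ∈ (C i).support} {v | v ∈ (C j).support}) ∧
    vertexInf x = ⋃ i, {v | v ∈ (C i).support} ∧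
    edgeInf G x = ⋃ i, {e | e ∈ (C i).edges}

end

end AntRW

/-! Call a jump good if it goes along an edge with positive crossing number. Good jumps only raise
positive crossing numbers and only lower nonpositive ones, so Monot follows once all jumps are
eventually good (`IsAntLaw.ae_eventually_isGoodJump`). At each vertex the outgoing crossing numbers
sum to the initial minus the current number of walkers there, hence to a value in `[-N, N]`
(`sum_crossing`). Their vector therefore grows as in (A2), up to changes of this sum. A walker with
a good jump available makes one with probability `Υ⁺ / (Υ⁺ + Υ⁻) ≥ exp (-Υ⁻ / Υ⁺)`, and every good
jump lowers a bounded nonnegative potential, built from the supremum in (A2), by at least the ratio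
paid (`potential_add_ratio_le`). So `exp (-potential)` does not decrease in conditional mean as long
as jumps are good.

The obstacle is a walker at a sink, from which no good jump leads. There all outgoing crossing
numbers lie in `[-N, 0]`, so each neighbour has probability bounded below. A circuit in `G` provides
a choice of one outgoing edge per vertex that never uses an edge in both directions
(`exists_escape`); pushing stuck walkers along it ends after boundedly many jumps, as counted by
`delay`. Together (`niceFactor_le`), from every past the conditional probability of eventually
making only good jumps is at least a fixed `p > 0`, and a zero-one law
(`measure_eq_zero_of_cyl_bound`) turns this into probability one.

If the maximum degree is at least `3`, an admissible sequence with one coordinate frozen at `0`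
gives the summability of `1 / W₁`. Then two edges leaving one vertex cannot both be crossed forever
in their positive directions: the difference of the tail sums of `1 / W₁` at the two crossing
numbers is balanced, and a second and fourth moment estimate keeps it from reaching `0` with
conditional probability at least `1 / 19` (`IsAntLaw.measure_bothDiverge`). In maximum degree at
most `2`, conservation of walkers already excludes this. Hence each vertex visited infinitely often
has a unique successor, and the orbits of the successor map are the required circuits
(`locTrapp_of_eventually_good`). -/

namespace AntRW

/-! ### Finite-time events, a zero-one law and a submartingale inequality on path space. -/

section Trajectories

set_option linter.unusedSectionVars false

variable {S : Type*}

/-- The trajectories that agree with `x` up to time `n`. -/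
def cyl (n : ℕ) (x : ℕ → S) : Set (ℕ → S) := {x' | ∀ m ≤ n, x' m = x m}

/-- A functional of the trajectory that only depends on the positions up to time `t`. -/
def AdaptedAt {β : Type*} (t : ℕ) (g : (ℕ → S) → β) : Prop :=
  ∀ x x' : ℕ → S, (∀ m ≤ t, x m = x' m) → g x = g x'

theorem AdaptedAt.mono {β : Type*} {s t : ℕ} {g : (ℕ → S) → β} (hg : AdaptedAt s g)
    (hst : s ≤ t) : AdaptedAt t g :=
  fun x x' h => hg x x' fun m hm => h m (hm.trans hst)

/-- The initial segment of a trajectory up to time `t`. -/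
def initSeg (t : ℕ) (x : ℕ → S) : Fin (t + 1) → S := fun i => x i

/-- The trajectory that continues an initial segment by standing still. -/
def extendSeg (t : ℕ) (r : Fin (t + 1) → S) : ℕ → S := fun m => r ⟨min m t, by omega⟩

theorem extendSeg_initSeg (t : ℕ) (x : ℕ → S) (m : ℕ) (hm : m ≤ t) :
    extendSeg t (initSeg t x) m = x m := by
  simp [extendSeg, initSeg, hm]

theorem initSeg_preimage (t : ℕ) (r : Fin (t + 1) → S) :
    initSeg t ⁻¹' {r} = cyl t (extendSeg t r) := by
  ext x
  simp only [Set.mem_preimage, Set.mem_singleton_iff, cyl, Set.mem_ofPred_eq]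
  constructor
  · rintro rfl m hm
    exact (extendSeg_initSeg t x m hm).symm
  · intro h
    funext i
    have hi : (i : ℕ) ≤ t := Nat.lt_succ_iff.mp i.2
    rw [initSeg, h i hi]
    simp [extendSeg, hi]

theorem AdaptedAt.eq_comp {β : Type*} {t : ℕ} {g : (ℕ → S) → β} (hg : AdaptedAt t g) :
    g = (fun r => g (extendSeg t r)) ∘ initSeg t := by
  funext x
  exact hg _ _ fun m hm => (extendSeg_initSeg t x m hm).symm

variable [Fintype S] [MeasurableSpace S] [MeasurableSingletonClass S]

theorem measurable_initSeg (t : ℕ) : Measurable (initSeg (S := S) t) :=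
  measurable_pi_lambda _ fun i => measurable_pi_apply (i : ℕ)

theorem AdaptedAt.measurable {β : Type*} [MeasurableSpace β] {t : ℕ} {g : (ℕ → S) → β}
    (hg : AdaptedAt t g) : Measurable g := by
  rw [hg.eq_comp]
  exact (measurable_of_finite _).comp (measurable_initSeg t)

theorem AdaptedAt.measurableSet {t : ℕ} {p : (ℕ → S) → Prop} (hp : AdaptedAt t p) :
    MeasurableSet {x | p x} :=
  measurableSet_setOfPred.mpr hp.measurable

theorem AdaptedAt.exists_bound {t : ℕ} {g : (ℕ → S) → ℝ} (hg : AdaptedAt t g) :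
    ∃ c, ∀ x, |g x| ≤ c := by
  obtain ⟨c, hc⟩ := (Set.finite_range fun r => |g (extendSeg t r)|).bddAbove
  refine ⟨c, fun x => ?_⟩
  rw [hg.eq_comp]
  exact hc ⟨initSeg t x, rfl⟩

theorem AdaptedAt.integrable {μ : Measure (ℕ → S)} [IsFiniteMeasure μ] {t : ℕ}
    {g : (ℕ → S) → ℝ} (hg : AdaptedAt t g) : Integrable g μ := by
  obtain ⟨c, hc⟩ := hg.exists_bound
  exact Integrable.of_bound hg.measurable.aestronglyMeasurable c (ae_of_all _ hc)

theorem measurableSet_cyl (n : ℕ) (x : ℕ → S) : MeasurableSet (cyl n x) := by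
  refine AdaptedAt.measurableSet (t := n) (p := fun x' => ∀ m ≤ n, x' m = x m) ?_
  intro y y' h
  exact propext ⟨fun h' m hm => (h m hm) ▸ h' m hm, fun h' m hm => (h m hm).symm ▸ h' m hm⟩

/-- Events decided at a finite time form an algebra generating the product σ-algebra, so every event
can be approximated in measure by such events. The zero-one law rests on this. -/
theorem isSetAlgebra_adapted :
    IsSetAlgebra {A : Set (ℕ → S) | ∃ t, AdaptedAt t (· ∈ A)} where
  empty_mem := ⟨0, fun _ _ _ => rfl⟩
  compl_mem := by
    rintro A ⟨t, ht⟩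
    exact ⟨t, fun x x' h => congrArg Not (ht x x' h)⟩
  union_mem := by
    rintro A B ⟨t, ht⟩ ⟨s, hs⟩
    refine ⟨max t s, fun x x' h => ?_⟩
    exact congrArg₂ Or (ht.mono (le_max_left _ _) x x' h) (hs.mono (le_max_right _ _) x x' h)

theorem generateFrom_adapted :
    (inferInstance : MeasurableSpace (ℕ → S))
      = MeasurableSpace.generateFrom {A : Set (ℕ → S) | ∃ t, AdaptedAt t (· ∈ A)} := by
  apply le_antisymm
  · refine iSup_le fun n => ?_
    rintro _ ⟨A, -, rfl⟩
    refine MeasurableSpace.measurableSet_generateFrom ⟨n, fun x x' h => ?_⟩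
    simp [h n le_rfl]
  · refine MeasurableSpace.generateFrom_le ?_
    rintro A ⟨t, ht⟩
    exact ht.measurableSet

/-- As `S` is finite, an event decided at time `t` is a finite disjoint union of cylinders, over
which the bound is summed. -/
theorem cyl_inter_bound_adapted {μ : Measure (ℕ → S)} [IsFiniteMeasure μ] {B : Set (ℕ → S)}
    {t : ℕ} {c : ℝ} (h : ∀ x, μ.real (B ∩ cyl t x) ≤ c * μ.real (cyl t x))
    {A : Set (ℕ → S)} (hA : AdaptedAt t (· ∈ A)) : μ.real (B ∩ A) ≤ c * μ.real A := by
  classical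
  set s : Finset (Fin (t + 1) → S) := Finset.univ.filter fun r => extendSeg t r ∈ A
  have hs : A = initSeg t ⁻¹' s := by
    ext x
    simp only [s, Finset.coe_filter, Finset.mem_univ, true_and, Set.mem_preimage,
      Set.mem_ofPred_eq]
    exact iff_of_eq (hA _ _ fun m hm => (extendSeg_initSeg t x m hm).symm)
  have key : ∀ ν : Measure (ℕ → S), IsFiniteMeasure ν →
      ν.real A = ∑ r ∈ s, ν.real (cyl t (extendSeg t r)) := by
    intro ν _
    rw [measureReal_def, hs, ← sum_measure_preimage_singleton s
      (fun r _ => measurable_initSeg t (measurableSet_singleton r)),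
      ENNReal.toReal_sum fun _ _ => measure_ne_top _ _]
    simp [initSeg_preimage, measureReal_def]
  have hAm : MeasurableSet A := hA.measurableSet
  have h1 := key (μ.restrict B) inferInstance
  simp only [measureReal_restrict_apply hAm, measureReal_restrict_apply (measurableSet_cyl _ _)]
    at h1
  rw [Set.inter_comm, h1, key μ inferInstance, Finset.mul_sum]
  exact Finset.sum_le_sum fun r _ => by rw [Set.inter_comm]; exact h _

/-- A zero-one law: an event whose conditional probability given the past stays away from `1` is
null. -/
theorem measure_eq_zero_of_cyl_bound {μ : Measure (ℕ → S)} [IsFiniteMeasure μ]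
    {B : Set (ℕ → S)} (hB : MeasurableSet B) {c : ℝ} (hc : c < 1) (m : ℕ)
    (h : ∀ n, m ≤ n → ∀ x, μ.real (B ∩ cyl n x) ≤ c * μ.real (cyl n x)) : μ B = 0 := by
  wlog hc0 : 0 ≤ c generalizing c
  · refine this (c := max c 0) (by simp [hc]) (fun n hn x => (h n hn x).trans ?_) (by simp)
    gcongr
    exact le_max_left _ _
  have hd : μ.MeasureDense {A : Set (ℕ → S) | ∃ t, AdaptedAt t (· ∈ A)} :=
    Measure.MeasureDense.of_generateFrom_isSetAlgebra_finite μ isSetAlgebra_adapted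
      generateFrom_adapted
  -- With `A` within `η` of `B` and decided at a finite time, `μ B ≤ μ (B ∩ A) + η ≤ c * μ A + η ≤ c
  -- * (μ B + η) + η`.
  have key : ∀ η : ℝ, 0 < η → (1 - c) * μ.real B ≤ 2 * η := by
    intro η hη
    obtain ⟨A, ⟨t, ht⟩, hAB⟩ := hd.approx B hB (measure_ne_top _ _) η hη
    have hAB' : μ.real (symmDiff B A) ≤ η := by
      rw [measureReal_def]
      exact ENNReal.toReal_le_of_le_ofReal hη.le hAB.le
    have hb := cyl_inter_bound_adapted (h (max m t) (le_max_left _ _))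
      (ht.mono (le_max_right m t))
    have h1 : μ.real B ≤ μ.real (B ∩ A) + μ.real (symmDiff B A) :=
      (measureReal_mono (fun x hx => by
        by_cases hxA : x ∈ A
        · exact Or.inl ⟨hx, hxA⟩
        · exact Or.inr (Or.inl ⟨hx, hxA⟩))).trans (measureReal_union_le _ _)
    have h2 : μ.real A ≤ μ.real B + μ.real (symmDiff B A) :=
      (measureReal_mono (fun x hx => by
        by_cases hxB : x ∈ B
        · exact Or.inl hxB
        · exact Or.inr (Or.inr ⟨hx, hxB⟩))).trans (measureReal_union_le _ _)
    nlinarith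
  have h0 : μ.real B ≤ 0 := by
    by_contra! hpos
    have := key ((1 - c) * μ.real B / 4) (by have := sub_pos.mpr hc; positivity)
    nlinarith [mul_pos (sub_pos.mpr hc) hpos]
  exact (measureReal_eq_zero_iff).mp (le_antisymm h0 measureReal_nonneg)

theorem cyl_eq_iUnion (n : ℕ) (x : ℕ → S) :
    cyl n x = ⋃ y : S, cyl (n + 1) (Function.update x (n + 1) y) := by
  ext z
  simp only [cyl, Set.mem_ofPred_eq, Set.mem_iUnion]
  constructor
  · intro h
    refine ⟨z (n + 1), fun m hm => ?_⟩
    rcases hm.lt_or_eq with hm | rfl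
    · rw [Function.update_of_ne (by omega), h m (by omega)]
    · simp
  · rintro ⟨y, hy⟩ m hm
    rw [hy m (by omega), Function.update_of_ne (by omega)]

/-- A functional that does not decrease in conditional mean along trajectories of positive
probability does not decrease in mean, conditionally on the past. -/
theorem le_integral_cyl {μ : Measure (ℕ → S)} [IsFiniteMeasure μ] {q : (ℕ → S) → ℕ → S → ℝ}
    (hq : ∀ n x, μ.real (cyl (n + 1) x) = μ.real (cyl n x) * q x n (x (n + 1)))
    (hqa : ∀ n y, AdaptedAt n fun x => q x n y)
    {g : ℕ → (ℕ → S) → ℝ} {n T : ℕ} (hga : ∀ t, n ≤ t → AdaptedAt t (g t)) (hnT : n ≤ T)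
    (hg : ∀ t, n ≤ t → t < T → ∀ x, μ.real (cyl t x) ≠ 0 →
      g t x ≤ ∑ y, q x t y * g (t + 1) (Function.update x (t + 1) y)) (x : ℕ → S) :
    μ.real (cyl n x) * g n x ≤ ∫ z in cyl n x, g T z ∂μ := by
  induction hnT using Nat.decreasingInduction generalizing x with
  | self =>
    have : ∫ z in cyl T x, g T z ∂μ = ∫ z in cyl T x, g T x ∂μ :=
      setIntegral_congr_fun (measurableSet_cyl T x) fun z hz => hga T le_rfl _ _ hz
    rw [this, setIntegral_const, smul_eq_mul]
  | of_succ k hk ih =>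
    have ih' := ih (fun t ht => hga t (by omega)) fun t ht => hg t (by omega)
    rw [cyl_eq_iUnion k x, integral_iUnion_fintype (fun y => measurableSet_cyl _ _),
      ← cyl_eq_iUnion]
    · refine le_trans ?_ (Finset.sum_le_sum fun y _ => ih' (Function.update x (k + 1) y))
      have h1 : ∀ y, μ.real (cyl (k + 1) (Function.update x (k + 1) y))
          = μ.real (cyl k x) * q x k y := by
        intro y
        have hx : ∀ m ≤ k, Function.update x (k + 1) y m = x m := fun m hm =>
          Function.update_of_ne (by omega) _ _
        rw [hq, show q _ k _ = _ from hqa k _ _ _ hx, Function.update_self]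
        congr 2
        ext z
        exact forall₂_congr fun m hm => by rw [hx m hm]
      simp only [h1, mul_assoc, ← Finset.mul_sum]
      -- The one-step inequality is available only on cylinders of positive measure; on the others
      -- both sides vanish.
      by_cases h0 : μ.real (cyl k x) = 0
      · simp [h0]
      · exact mul_le_mul_of_nonneg_left (hg k le_rfl hk x h0) measureReal_nonneg
    · intro y y' hyy
      refine Set.disjoint_left.mpr fun z hz hz' => hyy ?_
      have h1 := hz (k + 1) le_rfl
      have h2 := hz' (k + 1) le_rfl
      simp only [Function.update_self] at h1 h2
      exact h1.symm.trans h2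
    · intro y
      exact (hga T hk.le).integrable.integrableOn

end Trajectories

end AntRW

namespace AntRW

/-! ### Crossing numbers, good jumps and conservation of walkers. -/

section Crossings

variable {V : Type*} [DecidableEq V] {N : ℕ}

theorem crossing_antisymm (x : ℕ → Fin N → V) (n : ℕ) (u v : V) :
    crossing x n u v = -crossing x n v u := by
  simp only [crossing, crossingOf, ← Finset.sum_neg_distrib, neg_sub]

theorem crossing_zero (x : ℕ → Fin N → V) (u v : V) : crossing x 0 u v = 0 := by
  simp [crossing, crossingOf]

theorem adaptedAt_crossing (n : ℕ) (u v : V) :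
    AdaptedAt n fun x : ℕ → Fin N → V => crossing x n u v := by
  intro x x' h
  refine Finset.sum_congr rfl fun i _ => Finset.sum_congr rfl fun m hm => ?_
  have hm' := Finset.mem_range.mp hm
  rw [h m (by omega), h (m + 1) (by omega)]

/-- The effect of a jump of walker `i` to `u` on the crossing numbers. -/
theorem crossing_succ {x : ℕ → Fin N → V} {n : ℕ} {i : Fin N} {u : V}
    (hx : x (n + 1) = Function.update (x n) i u) (a b : V) :
    crossing x (n + 1) a b = crossing x n a b
      + ((if x n i = a ∧ u = b then 1 else 0) - (if x n i = b ∧ u = a then 1 else 0)) := by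
  simp only [crossing, crossingOf, Finset.sum_range_succ, Finset.sum_add_distrib]
  congr 1
  rw [Finset.sum_eq_single i]
  · simp [hx, Prod.ext_iff]
  · intro j _ hj
    simp only [hx, Function.update_of_ne hj, Prod.mk.injEq]
    by_cases h1 : x n j = a <;> by_cases h2 : x n j = b <;> simp [h1, h2]
  · simp

/-- Some walker jumps to a neighbour at time `t`. -/
def IsJump (G : SimpleGraph V) (x : ℕ → Fin N → V) (t : ℕ) : Prop :=
  ∃ i u, G.Adj (x t i) u ∧ x (t + 1) = Function.update (x t) i u

/-- Some walker jumps at time `t` along an edge with positive crossing number. -/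
def IsGoodJump (G : SimpleGraph V) (x : ℕ → Fin N → V) (t : ℕ) : Prop :=
  ∃ i u, G.Adj (x t i) u ∧ 0 < crossing x t (x t i) u ∧ x (t + 1) = Function.update (x t) i u

theorem IsGoodJump.isJump {G : SimpleGraph V} {x : ℕ → Fin N → V} {t : ℕ}
    (h : IsGoodJump G x t) : IsJump G x t :=
  let ⟨i, u, hu, _, hx⟩ := h
  ⟨i, u, hu, hx⟩

theorem adaptedAt_isJump (G : SimpleGraph V) (t : ℕ) : AdaptedAt (t + 1) fun x : ℕ → Fin N → V => IsJump G x t := by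
  intro x x' h
  simp only [IsJump, h t (by omega), h (t + 1) le_rfl]

theorem adaptedAt_isGoodJump (G : SimpleGraph V) (t : ℕ) :
    AdaptedAt (t + 1) fun x : ℕ → Fin N → V => IsGoodJump G x t := by
  intro x x' h
  have hc : ∀ a b, crossing x t a b = crossing x' t a b :=
    fun a b => adaptedAt_crossing t a b _ _ fun m hm => h m (by omega)
  simp only [IsGoodJump, hc, h t (by omega), h (t + 1) le_rfl]

/-- A jump along `p → u` with positive crossing number only increases positive crossing numbers
and only decreases negative ones. -/
theorem crossing_mono_of_good {x : ℕ → Fin N → V} {n : ℕ} {i : Fin N} {u : V}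
    (hx : x (n + 1) = Function.update (x n) i u) (hc : 0 < crossing x n (x n i) u) (a b : V) :
    (0 < crossing x n a b → crossing x n a b ≤ crossing x (n + 1) a b) ∧
      (crossing x n a b ≤ 0 → crossing x (n + 1) a b ≤ crossing x n a b) := by
  have hs := crossing_succ hx a b
  have ha := crossing_antisymm x n (x n i) u
  constructor
  · intro h
    split_ifs at hs with h1 h2 h2
    · omega
    · omega
    · obtain ⟨rfl, rfl⟩ := h2
      omega
    · omega
  · intro h
    split_ifs at hs with h1 h2 h2
    · omega
    · obtain ⟨rfl, rfl⟩ := h1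
      omega
    · omega
    · omega

/-- The number of walkers at `v` in the configuration `y`. -/
def occupation (y : Fin N → V) (v : V) : ℕ := (Finset.univ.filter fun i => y i = v).card

theorem occupation_le (y : Fin N → V) (v : V) : occupation y v ≤ N := by
  simpa [occupation] using Finset.card_filter_le (Finset.univ : Finset (Fin N)) fun i => y i = v

theorem occupation_pos {y : Fin N → V} {v : V} : 0 < occupation y v ↔ ∃ i, y i = v := by
  simp [occupation, Finset.card_pos, Finset.filter_nonempty_iff]

theorem occupation_update (y : Fin N → V) (i : Fin N) (u v : V) :
    (occupation (Function.update y i u) v : ℤ)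
      = occupation y v + ((if u = v then 1 else 0) - (if y i = v then 1 else 0)) := by
  simp only [occupation, Finset.card_filter, Nat.cast_sum]
  rw [← Finset.add_sum_erase _ _ (Finset.mem_univ i),
    ← Finset.add_sum_erase (Finset.univ) (fun j => ((if y j = v then 1 else 0 : ℕ) : ℤ))
      (Finset.mem_univ i)]
  rw [Finset.sum_congr rfl fun j hj => by rw [Function.update_of_ne (Finset.ne_of_mem_erase hj)]]
  simp only [Function.update_self]
  push_cast
  ring

variable [Fintype V] (G : SimpleGraph V) [DecidableRel G.Adj]

/-- Conservation of the number of walkers at each vertex. -/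
theorem sum_crossing {x : ℕ → Fin N → V} {n : ℕ} (h : ∀ m < n, IsJump G x m) (v : V) :
    ∑ w ∈ G.neighborFinset v, crossing x n v w
      = (occupation (x 0) v : ℤ) - occupation (x n) v := by
  induction n with
  | zero => simp [crossing_zero]
  | succ n ih =>
    obtain ⟨i, u, hu, hx⟩ := h n (by omega)
    have key : ∑ w ∈ G.neighborFinset v,
        (((if x n i = v ∧ u = w then 1 else 0) - (if x n i = w ∧ u = v then 1 else 0) : ℤ))
        = (if x n i = v then 1 else 0) - (if u = v then 1 else 0) := by
      rw [Finset.sum_sub_distrib]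
      congr 1
      · by_cases hv : x n i = v
        · subst hv
          simp [hu]
        · simp [hv]
      · by_cases hv : u = v
        · subst hv
          simp [hu.symm]
        · simp [hv]
    simp only [crossing_succ hx, Finset.sum_add_distrib, key,
      ih fun m hm => h m (by omega)]
    rw [hx, occupation_update]
    ring

theorem abs_sum_crossing_le {x : ℕ → Fin N → V} {n : ℕ} (h : ∀ m < n, IsJump G x m) (v : V) :
    -(N : ℤ) ≤ ∑ w ∈ G.neighborFinset v, crossing x n v w ∧
      ∑ w ∈ G.neighborFinset v, crossing x n v w ≤ N := by
  rw [sum_crossing G h]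
  have h1 := occupation_le (x 0) v
  have h2 := occupation_le (x n) v
  omega

end Crossings

/-! ### Transition probabilities and the law of the walk on path space. -/

section Steps

set_option linter.unusedSectionVars false

variable {V : Type*} [Fintype V] [DecidableEq V] (G : SimpleGraph V) [DecidableRel G.Adj]
  {N : ℕ} (W₁ W₂ : ℕ → ℝ)

/-- The probability that a walker at `v` jumps to `u` at time `n`. -/
noncomputable def jumpProb (x : ℕ → Fin N → V) (n : ℕ) (v u : V) : ℝ :=
  weight W₁ W₂ (crossing x n v u) / ∑ w ∈ G.neighborFinset v, weight W₁ W₂ (crossing x n v w)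

theorem weight_pos {W₁ W₂ : ℕ → ℝ} (hW₁ : ∀ k, 0 < W₁ k) (hW₂ : ∀ k, 0 < W₂ k) (k : ℤ) :
    0 < weight W₁ W₂ k := by
  unfold weight
  split_ifs
  exacts [hW₁ _, hW₂ _]

theorem jumpProb_nonneg {W₁ W₂ : ℕ → ℝ} (hW₁ : ∀ k, 0 < W₁ k) (hW₂ : ∀ k, 0 < W₂ k)
    (x : ℕ → Fin N → V) (n : ℕ) (v u : V) : 0 ≤ jumpProb G W₁ W₂ x n v u :=
  div_nonneg (weight_pos hW₁ hW₂ _).le (Finset.sum_nonneg fun _ _ => (weight_pos hW₁ hW₂ _).le)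

theorem sum_jumpProb {W₁ W₂ : ℕ → ℝ} (hW₁ : ∀ k, 0 < W₁ k) (hW₂ : ∀ k, 0 < W₂ k)
    (x : ℕ → Fin N → V) (n : ℕ) {v : V} (hv : ∃ u, G.Adj v u) :
    ∑ u ∈ G.neighborFinset v, jumpProb G W₁ W₂ x n v u = 1 := by
  obtain ⟨u, hu⟩ := hv
  simp only [jumpProb, ← Finset.sum_div]
  exact div_self (Finset.sum_pos (fun _ _ => weight_pos hW₁ hW₂ _)
    ⟨u, (G.mem_neighborFinset v u).mpr hu⟩).ne'

theorem sum_stepProb_mul (x : ℕ → Fin N → V) (n : ℕ) (g : (Fin N → V) → ℝ) :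
    ∑ y, stepProb G W₁ W₂ x n y * g y = ∑ i : Fin N, (1 / (N : ℝ)) *
      ∑ u ∈ G.neighborFinset (x n i),
        jumpProb G W₁ W₂ x n (x n i) u * g (Function.update (x n) i u) := by
  simp only [stepProb, Finset.sum_mul, mul_assoc]
  rw [Finset.sum_comm]
  refine Finset.sum_congr rfl fun i _ => ?_
  rw [← Finset.mul_sum, Finset.sum_comm]
  congr 1
  refine Finset.sum_congr rfl fun u _ => ?_
  simp [ite_mul, jumpProb]

theorem adaptedAt_stepProb (n : ℕ) (y : Fin N → V) :
    AdaptedAt n fun x => stepProb G W₁ W₂ x n y := by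
  intro x x' h
  have hc : ∀ a b, crossing x n a b = crossing x' n a b := fun a b => adaptedAt_crossing n a b _ _ h
  simp only [stepProb, hc]
  rw [h n le_rfl]

theorem isJump_of_stepProb_ne_zero {x : ℕ → Fin N → V} {n : ℕ}
    (h : stepProb G W₁ W₂ x n (x (n + 1)) ≠ 0) : IsJump G x n := by
  by_contra hx
  refine h (Finset.sum_eq_zero fun i _ => ?_)
  rw [Finset.sum_eq_zero, mul_zero]
  intro u hu
  rw [if_neg]
  exact fun hxu => hx ⟨i, u, (G.mem_neighborFinset _ _).mp hu, hxu⟩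

/-- The trajectory obtained from `x` by letting walker `i` jump to `u` at time `t`. -/
def jumpTo (x : ℕ → Fin N → V) (t : ℕ) (i : Fin N) (u : V) : ℕ → Fin N → V :=
  Function.update x (t + 1) (Function.update (x t) i u)

theorem jumpTo_of_le (x : ℕ → Fin N → V) {t m : ℕ} (i : Fin N) (u : V) (hm : m ≤ t) :
    jumpTo x t i u m = x m := Function.update_of_ne (by omega) _ _

theorem jumpTo_succ (x : ℕ → Fin N → V) (t : ℕ) (i : Fin N) (u : V) :
    jumpTo x t i u (t + 1) = Function.update (jumpTo x t i u t) i u := by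
  rw [jumpTo_of_le x i u le_rfl, jumpTo, Function.update_self]

/-- The law of an Ant random walk on the space of trajectories. -/
structure IsAntLaw [MeasurableSpace V] (μ : Measure (ℕ → Fin N → V)) : Prop where
  prob : IsProbabilityMeasure μ
  transition : ∀ n x, μ.real (cyl (n + 1) x)
    = μ.real (cyl n x) * stepProb G W₁ W₂ x n (x (n + 1))

variable {G W₁ W₂} [MeasurableSpace V] [MeasurableSingletonClass V]
  {μ : Measure (ℕ → Fin N → V)}

theorem IsAntLaw.isJump_of_cyl (hμ : IsAntLaw G W₁ W₂ μ) {n : ℕ} {x : ℕ → Fin N → V}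
    (h : μ.real (cyl n x) ≠ 0) : ∀ m < n, IsJump G x m := by
  induction n with
  | zero => intro m hm; omega
  | succ n ih =>
    rw [hμ.transition] at h
    intro m hm
    rcases Nat.lt_succ_iff_lt_or_eq.mp hm with hm | rfl
    · exact ih (left_ne_zero_of_mul h) m hm
    · exact isJump_of_stepProb_ne_zero G W₁ W₂ (right_ne_zero_of_mul h)

/-- Trajectories that do not consist of jumps to neighbours carry no mass, so conservation of
walkers may be used when checking the one-step inequality. -/
theorem IsAntLaw.le_integral (hμ : IsAntLaw G W₁ W₂ μ) {g : ℕ → (ℕ → Fin N → V) → ℝ}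
    {n T : ℕ} (hga : ∀ t, n ≤ t → AdaptedAt t (g t)) (hnT : n ≤ T)
    (hg : ∀ t, n ≤ t → t < T → ∀ x, (∀ m < t, IsJump G x m) →
      g t x ≤ ∑ i : Fin N, (1 / (N : ℝ)) * ∑ u ∈ G.neighborFinset (x t i),
        jumpProb G W₁ W₂ x t (x t i) u * g (t + 1) (jumpTo x t i u))
    (x : ℕ → Fin N → V) :
    μ.real (cyl n x) * g n x ≤ ∫ z in cyl n x, g T z ∂μ := by
  have := hμ.prob
  refine le_integral_cyl hμ.transition (adaptedAt_stepProb G W₁ W₂) hga hnT ?_ x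
  intro t ht htT x hx
  rw [sum_stepProb_mul]
  exact hg t ht htT x (hμ.isJump_of_cyl hx)

end Steps

end AntRW

namespace AntRW

/-! ### The budget of ratios that (A2) leaves to a single vertex. -/

section Potential

/-- `ψ` arises from `φ` by raising positive coordinates and lowering nonpositive ones. -/
def Extends {d : ℕ} (φ ψ : Fin d → ℤ) : Prop :=
  ∀ j, (0 < φ j → φ j ≤ ψ j) ∧ (φ j ≤ 0 → ψ j ≤ φ j)

theorem Extends.refl {d : ℕ} (φ : Fin d → ℤ) : Extends φ φ := fun _ => ⟨fun _ => le_rfl, fun _ => le_rfl⟩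

theorem Extends.trans {d : ℕ} {φ ψ χ : Fin d → ℤ} (h₁ : Extends φ ψ) (h₂ : Extends ψ χ) :
    Extends φ χ := by
  intro j
  have := h₁ j
  have := h₂ j
  constructor <;> intro <;> omega

/-- The summand `Υ⁻(φ) / Υ⁺(φ)`. -/
noncomputable def ratio (W₁ W₂ : ℕ → ℝ) {d : ℕ} (φ : Fin d → ℤ) : ℝ :=
  upsilonNeg W₂ φ / upsilonPos W₁ φ

/-- The largest total of `Υ⁻ / Υ⁺` along admissible sequences with coordinate sum `D` that start at
a vector extending `φ`. -/
noncomputable def reserve (Δ N : ℕ) (W₁ W₂ : ℕ → ℝ) (D : ℤ) {d : ℕ} (φ : Fin d → ℤ) : ENNReal :=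
  ⨆ s ∈ {s : ℕ → Fin d → ℤ | (⟨d, s⟩ : Σ d : ℕ, ℕ → Fin d → ℤ) ∈ admissible Δ N ∧
    ∑ j, s 0 j = D ∧ Extends φ (s 0)}, ∑' n, ENNReal.ofReal (ratio W₁ W₂ (s n))

variable {Δ N : ℕ} {W₁ W₂ : ℕ → ℝ}

theorem reserve_le (D : ℤ) {d : ℕ} (φ : Fin d → ℤ) :
    reserve Δ N W₁ W₂ D φ ≤ ⨆ s ∈ admissible Δ N,
      ∑' n, ENNReal.ofReal (upsilonNeg W₂ (s.2 n) / upsilonPos W₁ (s.2 n)) :=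
  iSup₂_le fun s hs => le_iSup₂_of_le (⟨d, s⟩ : Σ d : ℕ, ℕ → Fin d → ℤ) hs.1 le_rfl

theorem reserve_ne_top (h : SummabilityCondition Δ N W₁ W₂) (D : ℤ) {d : ℕ} (φ : Fin d → ℤ) :
    reserve Δ N W₁ W₂ D φ ≠ ⊤ := ((reserve_le D φ).trans_lt h).ne

/-- The label `D` is not tied to the coordinate sum of `φ`. Hence monotonicity persists when a
walker arrives or leaves and changes that sum, which is why `potential` keeps one reserve for each
possible sum. -/
theorem reserve_anti (D : ℤ) {d : ℕ} {φ ψ : Fin d → ℤ} (h : Extends φ ψ) :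
    reserve Δ N W₁ W₂ D ψ ≤ reserve Δ N W₁ W₂ D φ :=
  iSup₂_le fun s hs => le_iSup₂_of_le s ⟨hs.1, hs.2.1, h.trans hs.2.2⟩ le_rfl

/-- One admissible step. -/
def UnitMove {d : ℕ} (φ ψ : Fin d → ℤ) : Prop :=
  ∃ j₁ j₂, (0 < φ j₁ ∧ ψ j₁ = φ j₁ + 1) ∧ (φ j₂ ≤ 0 ∧ ψ j₂ = φ j₂ - 1) ∧
    ∀ j, j ≠ j₁ → j ≠ j₂ → ψ j = φ j

/-- The vector obtained from `φ` by raising `j₁` and lowering `j₂` by `k`. -/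
def shift {d : ℕ} (φ : Fin d → ℤ) (j₁ j₂ : Fin d) (k : ℤ) : Fin d → ℤ :=
  fun j => φ j + ((if j = j₁ then k else 0) - if j = j₂ then k else 0)

theorem sum_shift {d : ℕ} (φ : Fin d → ℤ) (j₁ j₂ : Fin d) (k : ℤ) :
    ∑ j, shift φ j₁ j₂ k j = ∑ j, φ j := by
  simp [shift, Finset.sum_add_distrib]

theorem unitMove_shift {d : ℕ} {φ : Fin d → ℤ} {j₁ j₂ : Fin d} (h₁ : 0 < φ j₁) (h₂ : φ j₂ ≤ 0)
    {k : ℤ} (hk : 0 ≤ k) : UnitMove (shift φ j₁ j₂ k) (shift φ j₁ j₂ (k + 1)) := by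
  have hne : j₁ ≠ j₂ := by rintro rfl; omega
  refine ⟨j₁, j₂, ?_, ?_, ?_⟩
  · simp only [shift, if_pos, if_neg hne]
    constructor <;> omega
  · simp only [shift, if_pos, if_neg hne.symm]
    constructor <;> omega
  · intro j hj₁ hj₂
    simp [shift, hj₁, hj₂]

theorem cons_mem_admissible {d : ℕ} {s : ℕ → Fin d → ℤ} {φ : Fin d → ℤ}
    (hs : (⟨d, s⟩ : Σ d : ℕ, ℕ → Fin d → ℤ) ∈ admissible Δ N) (hsum : ∑ j, φ j = ∑ j, s 0 j)
    (hm : UnitMove φ (s 0)) :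
    (⟨d, fun n => n.casesOn φ s⟩ : Σ d : ℕ, ℕ → Fin d → ℤ) ∈ admissible Δ N := by
  refine ⟨hs.1, fun n => ?_, fun n => ?_⟩
  · cases n with
    | zero =>
      have := hs.2.1 0
      simpa [hsum] using this
    | succ n => exact hs.2.1 n
  · cases n with
    | zero => exact hm
    | succ n => exact hs.2.2 n

/-- Equal sums force one coordinate that must still rise and one that must still fall; `Extends`
gives them the signs that an admissible step requires. -/
theorem exists_unitMove_towards {d : ℕ} {φ ψ : Fin d → ℤ} (h : Extends φ ψ) (hne : φ ≠ ψ)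
    (hsum : ∑ j, φ j = ∑ j, ψ j) :
    ∃ χ, UnitMove φ χ ∧ Extends χ ψ ∧ ∑ j, χ j = ∑ j, φ j ∧
      ∑ j, (ψ j - χ j).natAbs < ∑ j, (ψ j - φ j).natAbs := by
  obtain ⟨j₁, hj₁⟩ : ∃ j, φ j < ψ j := by
    by_contra! hle
    exact hne (funext fun j => ((Finset.sum_eq_sum_iff_of_le fun j _ => hle j).mp hsum.symm j
      (Finset.mem_univ j)).symm)
  obtain ⟨j₂, hj₂⟩ : ∃ j, ψ j < φ j := by
    by_contra! hle
    exact hne (funext fun j => (Finset.sum_eq_sum_iff_of_le fun j _ => hle j).mp hsum j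
      (Finset.mem_univ j))
  have h₁ : 0 < φ j₁ := by have := h j₁; omega
  have h₂ : φ j₂ ≤ 0 := by have := h j₂; omega
  have hne' : j₁ ≠ j₂ := by rintro rfl; omega
  have h0 : shift φ j₁ j₂ 0 = φ := by funext j; simp [shift]
  have hu := unitMove_shift h₁ h₂ le_rfl
  rw [h0, zero_add] at hu
  refine ⟨shift φ j₁ j₂ 1, hu, fun j => ?_, sum_shift _ _ _ _, ?_⟩
  · have := h j
    by_cases e₁ : j = j₁
    · subst e₁
      simp only [shift, if_pos, if_neg hne']
      constructor <;> intro <;> omega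
    · by_cases e₂ : j = j₂
      · subst e₂
        simp only [shift, if_pos, if_neg e₁]
        constructor <;> intro <;> omega
      · simpa [shift, e₁, e₂] using this
  · refine Finset.sum_lt_sum (fun j _ => ?_) ⟨j₁, Finset.mem_univ _, ?_⟩
    · by_cases e₁ : j = j₁
      · subst e₁
        simp only [shift, if_pos, if_neg hne']
        omega
      · by_cases e₂ : j = j₂
        · subst e₂
          simp only [shift, if_pos, if_neg e₁]
          omega
        · simp [shift, e₁, e₂]
    · simp only [shift, if_pos, if_neg hne']
      omega

/-- Induction on the `ℓ¹` distance from `φ` to `s 0`: unit moves are prepended to `s`. The inserted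
terms only add to the total, and the first of them is the ratio at `φ`. -/
theorem exists_admissible_from {d : ℕ} {s : ℕ → Fin d → ℤ}
    (hs : (⟨d, s⟩ : Σ d : ℕ, ℕ → Fin d → ℤ) ∈ admissible Δ N) {φ : Fin d → ℤ}
    (h : Extends φ (s 0)) (hne : φ ≠ s 0) (hsum : ∑ j, φ j = ∑ j, s 0 j) :
    ∃ s' : ℕ → Fin d → ℤ, (⟨d, s'⟩ : Σ d : ℕ, ℕ → Fin d → ℤ) ∈ admissible Δ N ∧ s' 0 = φ ∧
      ENNReal.ofReal (ratio W₁ W₂ φ) + ∑' n, ENNReal.ofReal (ratio W₁ W₂ (s n))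
        ≤ ∑' n, ENNReal.ofReal (ratio W₁ W₂ (s' n)) := by
  induction hk : ∑ j, (s 0 j - φ j).natAbs using Nat.strong_induction_on generalizing φ with
  | _ k ih =>
    obtain ⟨χ, hm, hχ, hχs, hlt⟩ := exists_unitMove_towards h hne hsum
    obtain ⟨s₁, hs₁, hs₁0, hle⟩ : ∃ s₁ : ℕ → Fin d → ℤ,
        (⟨d, s₁⟩ : Σ d : ℕ, ℕ → Fin d → ℤ) ∈ admissible Δ N ∧ s₁ 0 = χ ∧
        ∑' n, ENNReal.ofReal (ratio W₁ W₂ (s n)) ≤ ∑' n, ENNReal.ofReal (ratio W₁ W₂ (s₁ n)) := by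
      by_cases hχ0 : χ = s 0
      · exact ⟨s, hs, hχ0.symm, le_rfl⟩
      · obtain ⟨s₁, h1, h2, h3⟩ := ih _ (hk ▸ hlt) hχ hχ0 (hχs.trans hsum) rfl
        exact ⟨s₁, h1, h2, le_add_self.trans h3⟩
    refine ⟨_, cons_mem_admissible (φ := φ) hs₁ (by rw [hs₁0, hχs]) (by rw [hs₁0]; exact hm), rfl, ?_⟩
    refine (add_le_add le_rfl hle).trans (le_of_eq (Eq.symm ?_))
    exact tsum_eq_zero_add' ENNReal.summable

/-- Needed when no admissible sequence continues the new vector. Raising `j₁` and lowering one fixed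
nonpositive coordinate forever is admissible from `φ`; without a nonpositive coordinate the ratio is
`0`. -/
theorem ratio_le_reserve {d : ℕ} (hd : d ≤ Δ) {φ : Fin d → ℤ} {j₁ : Fin d} (h₁ : 0 < φ j₁)
    (hsum : -(N : ℤ) ≤ ∑ j, φ j ∧ ∑ j, φ j ≤ N) :
    ENNReal.ofReal (ratio W₁ W₂ φ) ≤ reserve Δ N W₁ W₂ (∑ j, φ j) φ := by
  by_cases h : ∃ j₂, φ j₂ ≤ 0
  · obtain ⟨j₂, h₂⟩ := h
    have h0 : shift φ j₁ j₂ 0 = φ := by funext j; simp [shift]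
    refine le_iSup₂_of_le (fun n : ℕ => shift φ j₁ j₂ n) ⟨⟨⟨?_, hd⟩, fun n => ?_, fun n => ?_⟩, ?_, ?_⟩ ?_
    · exact j₁.pos
    · simpa [sum_shift] using hsum
    · change UnitMove (shift φ j₁ j₂ (n : ℤ)) (shift φ j₁ j₂ ((n + 1 : ℕ) : ℤ))
      rw [Nat.cast_succ]
      exact unitMove_shift h₁ h₂ (Int.natCast_nonneg n)
    · simp [h0]
    · simpa [h0] using Extends.refl φ
    · refine le_trans ?_ (ENNReal.le_tsum 0)
      simp [h0]
  · push Not at h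
    have : upsilonNeg W₂ φ = 0 := by
      rw [upsilonNeg, Finset.filter_false_of_mem, Finset.sum_empty]
      intro j _
      simpa using h j
    simp [ratio, this]

/-- A departure through the coordinate `j₁` uses up the ratio at the current vector. -/
theorem ratio_add_reserve_le {d : ℕ} (hd : d ≤ Δ) {φ ψ : Fin d → ℤ} {j₁ : Fin d} (h₁ : 0 < φ j₁)
    (hψ : Extends φ ψ) (hψ₁ : φ j₁ < ψ j₁)
    (hsum : -(N : ℤ) ≤ ∑ j, φ j ∧ ∑ j, φ j ≤ N) :
    ENNReal.ofReal (ratio W₁ W₂ φ) + reserve Δ N W₁ W₂ (∑ j, φ j) ψ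
      ≤ reserve Δ N W₁ W₂ (∑ j, φ j) φ := by
  by_cases hne : ∃ s : ℕ → Fin d → ℤ, s ∈ {s : ℕ → Fin d → ℤ |
      (⟨d, s⟩ : Σ d : ℕ, ℕ → Fin d → ℤ) ∈ admissible Δ N ∧
      ∑ j, s 0 j = ∑ j, φ j ∧ Extends ψ (s 0)}
  · nth_rw 1 [reserve]
    rw [ENNReal.add_biSup hne]
    refine iSup₂_le fun s hs => ?_
    obtain ⟨hs, hs0, hψs⟩ := hs
    -- The strict increase at `j₁` makes `s 0` differ from `φ`, so at least one move is prepended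
    -- and the ratio at `φ` is really paid.
    obtain ⟨s', hs', hs'0, hle⟩ := exists_admissible_from (W₁ := W₁) (W₂ := W₂) hs
      (hψ.trans hψs) (fun h => by have := hψs j₁; have := congrFun h j₁; omega) hs0.symm
    refine hle.trans (le_iSup₂_of_le s' ⟨hs', by rw [hs'0], ?_⟩ le_rfl)
    rw [hs'0]
    exact Extends.refl φ
  · have : reserve Δ N W₁ W₂ (∑ j, φ j) ψ = 0 := by
      refine le_antisymm (iSup₂_le fun s hs => (hne ⟨s, hs⟩).elim) zero_le
    rw [this, add_zero]
    exact ratio_le_reserve hd h₁ hsum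

end Potential

/-! ### The global potential and its decrease along good jumps. -/

section VertexPotential

variable {V : Type*} [Fintype V] [DecidableEq V] (G : SimpleGraph V) [DecidableRel G.Adj]
  {N : ℕ} (W₁ W₂ : ℕ → ℝ)

/-- An enumeration of the neighbours of a vertex. -/
noncomputable def nbr (v : V) : Fin (G.degree v) ≃ G.neighborFinset v :=
  (G.neighborFinset v).equivFin.symm

/-- The crossing numbers of the edges that leave `v`. -/
noncomputable def localCrossing (x : ℕ → Fin N → V) (t : ℕ) (v : V) : Fin (G.degree v) → ℤ :=
  fun j => crossing x t v (nbr G v j)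

theorem sum_nbr {β : Type*} [AddCommMonoid β] (v : V) (g : V → β) :
    ∑ j : Fin (G.degree v), g (nbr G v j) = ∑ w ∈ G.neighborFinset v, g w :=
  ((nbr G v).sum_comp fun w => g w).trans (Finset.sum_coe_sort (G.neighborFinset v) g)

theorem adaptedAt_localCrossing (t : ℕ) (v : V) :
    AdaptedAt t fun x : ℕ → Fin N → V => localCrossing G x t v :=
  fun _ _ h => funext fun _ => adaptedAt_crossing t _ _ _ _ h

/-- The potential that decreases along jumps with positive crossing number. -/
noncomputable def potential (x : ℕ → Fin N → V) (t : ℕ) : ℝ :=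
  ∑ v : V, ∑ D ∈ Finset.Icc (-(N : ℤ)) N,
    (reserve G.maxDegree N W₁ W₂ D (localCrossing G x t v)).toReal

theorem adaptedAt_potential (t : ℕ) :
    AdaptedAt t fun x : ℕ → Fin N → V => potential G W₁ W₂ x t := by
  intro x x' h
  have hl : ∀ v, localCrossing G x t v = localCrossing G x' t v :=
    fun v => adaptedAt_localCrossing G t v _ _ h
  simp only [potential, hl]

theorem potential_nonneg (x : ℕ → Fin N → V) (t : ℕ) : 0 ≤ potential G W₁ W₂ x t :=
  Finset.sum_nonneg fun _ _ => Finset.sum_nonneg fun _ _ => ENNReal.toReal_nonneg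

variable {G W₁ W₂}

theorem exists_potential_le (h : SummabilityCondition G.maxDegree N W₁ W₂) :
    ∃ K, ∀ (x : ℕ → Fin N → V) (t : ℕ), potential G W₁ W₂ x t ≤ K :=
  ⟨_, fun _ _ => Finset.sum_le_sum fun _ _ => Finset.sum_le_sum fun D _ =>
    ENNReal.toReal_mono h.ne (reserve_le D _)⟩

/-- A good jump extends the local vector at every vertex, so no reserve grows. The reserve at the
departure vertex whose label is the current coordinate sum pays for the ratio. -/
theorem potential_add_ratio_le (h : SummabilityCondition G.maxDegree N W₁ W₂)
    (hW₁ : ∀ k, 0 < W₁ k) (hW₂ : ∀ k, 0 < W₂ k)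
    {x : ℕ → Fin N → V} {t : ℕ} (hx : ∀ m < t, IsJump G x m) {i : Fin N} {u : V}
    (hu : G.Adj (x t i) u) (hc : 0 < crossing x t (x t i) u)
    (hxt : x (t + 1) = Function.update (x t) i u) :
    potential G W₁ W₂ x (t + 1) + ratio W₁ W₂ (localCrossing G x t (x t i))
      ≤ potential G W₁ W₂ x t := by
  set v := x t i
  set φ := localCrossing G x t v
  have hsum : -(N : ℤ) ≤ ∑ j, φ j ∧ ∑ j, φ j ≤ N := by
    have := abs_sum_crossing_le G hx v
    rwa [← sum_nbr] at this
  have hext : ∀ w, Extends (localCrossing G x t w) (localCrossing G x (t + 1) w) :=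
    fun w j => crossing_mono_of_good hxt hc w _
  have hr0 : 0 ≤ ratio W₁ W₂ φ :=
    div_nonneg (Finset.sum_nonneg fun _ _ => (hW₂ _).le) (Finset.sum_nonneg fun _ _ => (hW₁ _).le)
  -- The ratio is placed on the single summand that pays for it, which allows a termwise comparison.
  have hr : ratio W₁ W₂ φ = ∑ w : V, ∑ D ∈ Finset.Icc (-(N : ℤ)) N,
      if w = v then if D = ∑ j, φ j then ratio W₁ W₂ φ else 0 else 0 := by
    rw [Finset.sum_eq_single v]
    · simp [hsum]
    · intro w _ hw
      simp [hw]
    · simp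
  rw [hr, potential, potential, ← Finset.sum_add_distrib]
  refine Finset.sum_le_sum fun w _ => ?_
  rw [← Finset.sum_add_distrib]
  refine Finset.sum_le_sum fun D _ => ?_
  have hanti := ENNReal.toReal_mono (reserve_ne_top h D _) (reserve_anti (W₁ := W₁) (W₂ := W₂)
    (Δ := G.maxDegree) (N := N) D (hext w))
  split_ifs with h1 h2
  · subst h1
    subst h2
    let j₁ := (nbr G v).symm ⟨u, (G.mem_neighborFinset _ _).mpr hu⟩
    have hj₁ : ((nbr G v j₁ : G.neighborFinset v) : V) = u := by simp [j₁]
    have key := ratio_add_reserve_le (W₁ := W₁) (W₂ := W₂) (Δ := G.maxDegree) (N := N)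
      (G.degree_le_maxDegree v) (φ := φ) (j₁ := j₁)
      (by simpa [φ, localCrossing, hj₁] using hc) (hext v)
      (by
        simp only [φ, localCrossing, hj₁]
        rw [crossing_succ hxt, if_pos ⟨rfl, rfl⟩, if_neg (fun h => hu.ne h.1)]
        omega) hsum
    have key' := ENNReal.toReal_mono (reserve_ne_top h _ _) key
    rw [ENNReal.toReal_add ENNReal.ofReal_ne_top (reserve_ne_top h _ _),
      ENNReal.toReal_ofReal hr0] at key'
    rw [add_comm]
    exact key'
  · simpa using hanti
  · simpa using hanti

/-- The total weight of the jumps with positive crossing number makes up for the ratio. -/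
theorem one_le_sum_jumpProb_mul_exp (hW₁ : ∀ k, 0 < W₁ k) (hW₂ : ∀ k, 0 < W₂ k)
    {x : ℕ → Fin N → V} {t : ℕ} {v : V} (hv : ∃ u, G.Adj v u ∧ 0 < crossing x t v u) :
    1 ≤ ∑ u ∈ G.neighborFinset v with 0 < crossing x t v u, jumpProb G W₁ W₂ x t v u
      * Real.exp (ratio W₁ W₂ (localCrossing G x t v)) := by
  set φ := localCrossing G x t v with hφ
  have hp : upsilonPos W₁ φ = ∑ u ∈ G.neighborFinset v with 0 < crossing x t v u,
      weight W₁ W₂ (crossing x t v u) := by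
    rw [upsilonPos, Finset.sum_filter, Finset.sum_filter, ← sum_nbr]
    refine Finset.sum_congr rfl fun j _ => ?_
    simp only [hφ, localCrossing, weight]
    split_ifs <;> rfl
  have hn : upsilonNeg W₂ φ = ∑ u ∈ G.neighborFinset v with ¬ 0 < crossing x t v u,
      weight W₁ W₂ (crossing x t v u) := by
    rw [upsilonNeg, Finset.sum_filter, Finset.sum_filter, ← sum_nbr]
    refine Finset.sum_congr rfl fun j _ => ?_
    simp only [hφ, localCrossing, weight, not_lt]
    split_ifs <;> first | rfl | omega
  have htot : ∑ w ∈ G.neighborFinset v, weight W₁ W₂ (crossing x t v w)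
      = upsilonPos W₁ φ + upsilonNeg W₂ φ := by
    rw [hp, hn, Finset.sum_filter_add_sum_filter_not]
  have hpos : 0 < upsilonPos W₁ φ := by
    rw [hp]
    obtain ⟨u, hu, hc⟩ := hv
    exact Finset.sum_pos (fun _ _ => weight_pos hW₁ hW₂ _)
      ⟨u, Finset.mem_filter.mpr ⟨(G.mem_neighborFinset _ _).mpr hu, hc⟩⟩
  have hneg : 0 ≤ upsilonNeg W₂ φ := Finset.sum_nonneg fun _ _ => (hW₂ _).le
  rw [← Finset.sum_mul]
  simp only [jumpProb]
  rw [← Finset.sum_div, ← hp, htot]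
  have hexp := Real.add_one_le_exp (ratio W₁ W₂ φ)
  calc (1 : ℝ) = upsilonPos W₁ φ / (upsilonPos W₁ φ + upsilonNeg W₂ φ) * (ratio W₁ W₂ φ + 1) := by
        rw [ratio]
        field_simp
        ring
    _ ≤ _ := by gcongr

end VertexPotential

end AntRW

namespace AntRW

/-! ### Freeing walkers that sit at sinks. -/

section Escape

/-- On a connected graph with a circuit one can choose an outgoing edge at every vertex such that
no edge is chosen in both directions. -/
theorem exists_escape {V : Type*} {G : SimpleGraph V} (hconn : G.Connected)
    (hcircuit : ¬ G.IsAcyclic) : ∃ f : V → V, (∀ v, G.Adj v (f v)) ∧ ∀ v, f (f v) ≠ v := by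
  classical
  rw [SimpleGraph.isAcyclic_iff_forall_adj_isBridge] at hcircuit
  push Not at hcircuit
  -- The edge `ab` lies on a circuit, so the graph stays connected without it. Every vertex other
  -- than `a` steps closer to `a` in the reduced graph, and `a` uses the deleted edge. Strictly
  -- decreasing distances exclude a return between vertices other than `a`; a return through `a`
  -- would need the deleted edge.
  obtain ⟨a, b, hab, hbr⟩ := hcircuit
  set G' := G.deleteEdges {s(a, b)}
  have hG' : G'.Connected := hconn.connected_delete_edge_of_not_isBridge hbr
  have hnext : ∀ v, v ≠ a → ∃ w, G'.Adj v w ∧ G'.dist w a < G'.dist v a := by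
    intro v hv
    obtain ⟨p, hp⟩ := (hG' v a).exists_walk_length_eq_dist
    cases p with
    | nil => exact (hv rfl).elim
    | cons h q =>
      refine ⟨_, h, ?_⟩
      have := SimpleGraph.dist_le q
      simp only [SimpleGraph.Walk.length_cons] at hp
      omega
  choose! g hg using hnext
  have hle : G' ≤ G := SimpleGraph.deleteEdges_le _
  refine ⟨fun v => if v = a then b else g v, fun v => ?_, fun v => ?_⟩
  · by_cases hv : v = a
    · simpa [hv] using hab
    · simpa [hv] using hle (hg v hv).1
  · by_cases hv : v = a
    · subst hv
      have hb : b ≠ v := hab.ne'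
      simp only [if_pos, if_neg hb]
      intro h
      have := (hg b hb).1
      rw [h] at this
      simp [G', Sym2.eq_swap] at this
    · simp only [if_neg hv]
      by_cases hgv : g v = a
      · simp only [hgv, if_pos]
        rintro rfl
        have := (hg b hv).1
        rw [hgv] at this
        simp [G', Sym2.eq_swap] at this
      · simp only [if_neg hgv]
        intro h
        have h1 := (hg v hv).2
        have h2 := (hg (g v) hgv).2
        rw [h] at h2
        omega

variable {V : Type*} [DecidableEq V] {N : ℕ}

/-- No edge that leaves `v` has positive crossing number. -/
def IsSink (G : SimpleGraph V) (x : ℕ → Fin N → V) (t : ℕ) (v : V) : Prop :=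
  ∀ w, G.Adj v w → crossing x t v w ≤ 0

/-- Some walker cannot make a jump with positive crossing number. -/
def Stuck (G : SimpleGraph V) (x : ℕ → Fin N → V) (t : ℕ) : Prop := ∃ i, IsSink G x t (x t i)

/-- The jump at time `t` has positive crossing number, except that as long as some walkers are stuck
one of them jumps in the direction prescribed by `f`. -/
def IsNiceJump (G : SimpleGraph V) (f : V → V) (x : ℕ → Fin N → V) (t : ℕ) : Prop :=
  (∃ i, IsSink G x t (x t i) ∧ x (t + 1) = Function.update (x t) i (f (x t i))) ∨
    (¬ Stuck G x t ∧ IsGoodJump G x t)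

open Classical in
/-- A bound for the number of jumps along `v → f v` that stuck walkers at `v` still have to make. -/
noncomputable def delay (G : SimpleGraph V) (f : V → V) (x : ℕ → Fin N → V) (t : ℕ) (v : V) : ℕ :=
  if 0 < crossing x t v (f v) then 0
  else if crossing x t v (f v) = 0 then 1
  else if IsSink G x t v ∧ ∃ i, x t i = v then (1 - crossing x t v (f v)).toNat
  else N + 1

theorem adaptedAt_isSink (G : SimpleGraph V) (t : ℕ) (v : V) :
    AdaptedAt t fun x : ℕ → Fin N → V => IsSink G x t v := by
  intro x x' h
  have hc : ∀ a b, crossing x t a b = crossing x' t a b := fun a b => adaptedAt_crossing t a b _ _ h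
  simp only [IsSink, hc]

theorem adaptedAt_stuck (G : SimpleGraph V) (t : ℕ) :
    AdaptedAt t fun x : ℕ → Fin N → V => Stuck G x t := by
  intro x x' h
  have hs : ∀ v, IsSink G x t v = IsSink G x' t v := fun v => adaptedAt_isSink G t v _ _ h
  simp only [Stuck, hs, h t le_rfl]

theorem adaptedAt_isNiceJump (G : SimpleGraph V) (f : V → V) (t : ℕ) :
    AdaptedAt (t + 1) fun x : ℕ → Fin N → V => IsNiceJump G f x t := by
  intro x x' h
  have h' : ∀ m ≤ t, x m = x' m := fun m hm => h m (by omega)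
  have hs : ∀ v, IsSink G x t v = IsSink G x' t v := fun v => adaptedAt_isSink G t v _ _ h'
  have hst : Stuck G x t = Stuck G x' t := adaptedAt_stuck G t _ _ h'
  have hg : IsGoodJump G x t = IsGoodJump G x' t := adaptedAt_isGoodJump G t _ _ h
  simp only [IsNiceJump, hs, hst, hg, h t (by omega), h (t + 1) le_rfl]

theorem adaptedAt_delay (G : SimpleGraph V) (f : V → V) (t : ℕ) (v : V) :
    AdaptedAt t fun x : ℕ → Fin N → V => delay G f x t v := by
  intro x x' h
  have hc : ∀ a b, crossing x t a b = crossing x' t a b := fun a b => adaptedAt_crossing t a b _ _ h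
  have hs : IsSink G x t v = IsSink G x' t v := adaptedAt_isSink G t v _ _ h
  have e : (IsSink G x t v ∧ ∃ i, x t i = v) = (IsSink G x' t v ∧ ∃ i, x' t i = v) := by
    rw [hs, h t le_rfl]
  simp only [delay, hc]
  by_cases p : IsSink G x' t v ∧ ∃ i, x' t i = v
  · have p' : IsSink G x t v ∧ ∃ i, x t i = v := e ▸ p
    simp only [if_pos p, if_pos p']
  · have p' : ¬(IsSink G x t v ∧ ∃ i, x t i = v) := e ▸ p
    simp only [if_neg p, if_neg p']

variable {f : V → V}

theorem IsNiceJump.isJump {G : SimpleGraph V} (hf : ∀ v, G.Adj v (f v)) {x : ℕ → Fin N → V}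
    {t : ℕ} (h : IsNiceJump G f x t) : IsJump G x t := by
  rcases h with ⟨i, -, hx⟩ | ⟨-, hx⟩
  · exact ⟨i, _, hf _, hx⟩
  · exact hx.isJump

variable [Fintype V] {G : SimpleGraph V} [DecidableRel G.Adj]

/-- By conservation the nonpositive outgoing crossing numbers at a sink sum to at least minus the
number of walkers there, so each one alone does too. -/
theorem IsSink.neg_occupation_le {x : ℕ → Fin N → V} {t : ℕ} (hx : ∀ m < t, IsJump G x m) {v w : V}
    (hs : IsSink G x t v) (hw : G.Adj v w) : -(occupation (x t) v : ℤ) ≤ crossing x t v w := by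
  have h1 := sum_crossing G hx v
  have hw' := (G.mem_neighborFinset v w).mpr hw
  rw [← Finset.add_sum_erase _ _ hw'] at h1
  have h2 : ∑ u ∈ (G.neighborFinset v).erase w, crossing x t v u ≤ 0 :=
    Finset.sum_nonpos fun u hu => hs u ((G.mem_neighborFinset v u).mp (Finset.mem_of_mem_erase hu))
  omega

theorem delay_le (hf : ∀ v, G.Adj v (f v)) {x : ℕ → Fin N → V} {t : ℕ}
    (hx : ∀ m < t, IsJump G x m) (v : V) : delay G f x t v ≤ N + 1 := by
  unfold delay
  split_ifs with h1 h2 h3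
  · omega
  · omega
  · have := h3.1.neg_occupation_le hx (hf v)
    have := occupation_le (x t) v
    omega
  · exact le_rfl

/-- Since `f` never uses an edge in both directions, the jump raises the crossing number of `(v, f
v)` and changes none of the other `(w, f w)`. Occupied sinks other than `v` remain occupied sinks,
so their delays do not jump up to `N + 1`. -/
theorem sum_delay_of_sink (hf : ∀ v, G.Adj v (f v)) (hff : ∀ v, f (f v) ≠ v)
    {x : ℕ → Fin N → V} {t : ℕ} (hx : ∀ m < t, IsJump G x m) {i : Fin N}
    (hs : IsSink G x t (x t i)) (hxt : x (t + 1) = Function.update (x t) i (f (x t i))) :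
    ∑ v, delay G f x (t + 1) v + 1 ≤ ∑ v, delay G f x t v := by
  have hx' : ∀ m < t + 1, IsJump G x m := by
    intro m hm
    rcases Nat.lt_succ_iff_lt_or_eq.mp hm with hm | rfl
    · exact hx m hm
    · exact ⟨i, _, hf _, hxt⟩
  obtain ⟨v, hv⟩ : ∃ v, v = x t i := ⟨_, rfl⟩
  rw [← hv] at hs
  rw [← hv] at hxt
  have hcs := fun a b => crossing_succ hxt a b
  rw [← hv] at hcs
  have ha : ∀ w, crossing x (t + 1) w (f w) = crossing x t w (f w) + if w = v then 1 else 0 := by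
    intro w
    rw [hcs, if_neg (fun h : v = f w ∧ f v = w => hff w (by rw [← h.1, h.2]))]
    by_cases hw : w = v
    · simp [hw]
    · simp [hw, Ne.symm hw]
  have hsv := hs (f v) (hf v)
  have hdv : delay G f x t v = (1 - crossing x t v (f v)).toNat := by
    have ht : IsSink G x t v ∧ ∃ i, x t i = v := ⟨hs, i, hv.symm⟩
    simp only [delay, if_pos ht]
    split_ifs <;> omega
  have hlt : delay G f x (t + 1) v < delay G f x t v := by
    have hav := ha v
    rw [if_pos rfl] at hav
    rw [hdv, delay]
    split_ifs with h1 h2 h3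
    · omega
    · omega
    · omega
    -- If the crossing number is still negative, `v` is still a sink, and by conservation a walker
    -- must remain there; the default value `N + 1` is then not taken.
    · refine (h3 ?_).elim
      have hs' : IsSink G x (t + 1) v := by
        intro w hw
        have := hs w hw
        rw [hcs]
        by_cases hwf : f v = w
        · rw [← hwf, if_neg (fun h : v = f v ∧ f v = v => (hf v).ne h.1)]
          rw [hcs] at h1
          simp only [true_and, if_true] at h1 ⊢
          rw [if_neg (fun h : v = f v ∧ f v = v => (hf v).ne h.1)] at h1
          omega
        · rw [if_neg (fun h : v = v ∧ f v = w => hwf h.2)]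
          split_ifs <;> omega
      refine ⟨hs', occupation_pos.mp ?_⟩
      have := hs'.neg_occupation_le hx' (hf v)
      omega
  refine Finset.sum_lt_sum (fun w _ => ?_) ⟨v, Finset.mem_univ _, hlt⟩
  by_cases hw : w = v
  · rw [hw]
    exact hlt.le
  · have haw := ha w
    rw [if_neg hw, add_zero] at haw
    have hd := delay_le hf hx' w
    by_cases ht : IsSink G x t w ∧ ∃ i, x t i = w
    · have ht' : IsSink G x (t + 1) w ∧ ∃ i, x (t + 1) i = w := by
        obtain ⟨hsw, j, hj⟩ := ht
        refine ⟨fun w' hw' => ?_, j, ?_⟩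
        · have := hsw w' hw'
          rw [hcs, if_neg (fun h : v = w ∧ _ => hw h.1.symm)]
          split_ifs <;> omega
        · rw [hxt, Function.update_of_ne, hj]
          rintro rfl
          exact hw (hj.symm.trans hv.symm)
      simp only [delay, haw, if_pos ht, if_pos ht']
      exact le_rfl
    · by_cases h0 : crossing x t w (f w) < 0
      · have : delay G f x t w = N + 1 := by
          rw [delay, if_neg (by omega), if_neg (by omega), if_neg ht]
        omega
      · simp only [delay, haw]
        split_ifs <;> omega

/-- Good jumps preserve positivity, and by antisymmetry they never touch a zero crossing number.
Where it is negative, the absence of occupied sinks means that the delay already has its maximal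
value `N + 1`. -/
theorem sum_delay_of_good (hf : ∀ v, G.Adj v (f v)) {x : ℕ → Fin N → V} {t : ℕ}
    (hx : ∀ m < t, IsJump G x m) (hns : ¬ Stuck G x t) (hg : IsGoodJump G x t) :
    ∑ v, delay G f x (t + 1) v ≤ ∑ v, delay G f x t v := by
  have hx' : ∀ m < t + 1, IsJump G x m := by
    intro m hm
    rcases Nat.lt_succ_iff_lt_or_eq.mp hm with hm | rfl
    · exact hx m hm
    · exact hg.isJump
  obtain ⟨i, u, hu, hc, hxt⟩ := hg
  refine Finset.sum_le_sum fun w _ => ?_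
  have h1 := crossing_mono_of_good hxt hc w (f w)
  have h2 := crossing_mono_of_good hxt hc (f w) w
  have h3 := crossing_antisymm x t w (f w)
  have h4 := crossing_antisymm x (t + 1) w (f w)
  have hd := delay_le hf hx' w
  have hnw : ¬ (IsSink G x t w ∧ ∃ i, x t i = w) := by
    rintro ⟨hs, j, rfl⟩
    exact hns ⟨j, hs⟩
  rcases lt_trichotomy (crossing x t w (f w)) 0 with h | h | h
  · have : delay G f x t w = N + 1 := by
      rw [delay, if_neg (by omega), if_neg (by omega), if_neg hnw]
    omega
  · have h5 : crossing x (t + 1) w (f w) = 0 := by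
      have := h1.2 (by omega)
      have := h2.2 (by omega)
      omega
    simp [delay, h, h5]
  · have h5 : 0 < crossing x (t + 1) w (f w) := by
      have := h1.1 h
      omega
    simp [delay, h, h5]

/-- The jumps of stuck walkers have probabilities bounded from below. -/
theorem exists_le_jumpProb_of_sink (W₁ : ℕ → ℝ) {W₂ : ℕ → ℝ} (hW₂ : ∀ k, 0 < W₂ k) :
    ∃ δ : ℝ, 0 < δ ∧ ∀ (x : ℕ → Fin N → V) (t : ℕ) (v u : V), (∀ m < t, IsJump G x m) →
      IsSink G x t v → G.Adj v u → δ ≤ jumpProb G W₁ W₂ x t v u := by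
  -- At a sink all outgoing crossing numbers lie in `[-N, 0]`, so only the values `W₂ 0, …, W₂ N`
  -- occur as weights.
  obtain ⟨k₀, -, hk₀⟩ := Finset.exists_min_image (Finset.range (N + 1)) W₂ ⟨0, by simp⟩
  set S := ∑ k ∈ Finset.range (N + 1), W₂ k
  have hS : 0 < S := Finset.sum_pos (fun k _ => hW₂ k) (Finset.nonempty_range_iff.mpr N.succ_ne_zero)
  have hw : ∀ (x : ℕ → Fin N → V) (t : ℕ) (v w : V), (∀ m < t, IsJump G x m) →
      IsSink G x t v → G.Adj v w → W₂ k₀ ≤ weight W₁ W₂ (crossing x t v w) ∧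
        weight W₁ W₂ (crossing x t v w) ≤ S := by
    intro x t v w hx hs hvw
    have h1 := hs w hvw
    have h2 := hs.neg_occupation_le hx hvw
    have h3 := occupation_le (x t) v
    have hmem : (-crossing x t v w).toNat ∈ Finset.range (N + 1) := by
      rw [Finset.mem_range]
      omega
    rw [weight, if_neg (by omega)]
    exact ⟨hk₀ _ hmem, Finset.single_le_sum (f := W₂) (s := Finset.range (N + 1)) (fun k _ => (hW₂ k).le) hmem⟩
  refine ⟨W₂ k₀ / ((Fintype.card V + 1) * S), div_pos (hW₂ _) (by positivity), ?_⟩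
  intro x t v u hx hs hvu
  have hden : ∑ w ∈ G.neighborFinset v, weight W₁ W₂ (crossing x t v w)
      ≤ (Fintype.card V + 1) * S := by
    refine (Finset.sum_le_card_nsmul _ _ S fun w hw' =>
      (hw x t v w hx hs ((G.mem_neighborFinset _ _).mp hw')).2).trans ?_
    rw [nsmul_eq_mul]
    gcongr
    have := Finset.card_le_univ (G.neighborFinset v)
    exact_mod_cast this.trans (Nat.le_succ _)
  have hpos : 0 < ∑ w ∈ G.neighborFinset v, weight W₁ W₂ (crossing x t v w) :=
    Finset.sum_pos (fun w hw' => (hW₂ k₀).trans_le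
      (hw x t v w hx hs ((G.mem_neighborFinset _ _).mp hw')).1)
      ⟨u, (G.mem_neighborFinset _ _).mpr hvu⟩
  rw [jumpProb]
  exact div_le_div₀ ((hW₂ k₀).le.trans (hw x t v u hx hs hvu).1) (hw x t v u hx hs hvu).1 hpos hden

end Escape

end AntRW

namespace AntRW

/-! ### Almost surely all jumps are eventually good. -/

section EventuallyGood

set_option linter.unusedSectionVars false

variable {V : Type*} [Fintype V] [DecidableEq V] {G : SimpleGraph V} [DecidableRel G.Adj]
  {N : ℕ} {W₁ W₂ : ℕ → ℝ}

open Classical in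
/-- The exponential of minus the expected cost of making only nice jumps, as long as all jumps since
time `n` are nice. -/
noncomputable def niceFactor (G : SimpleGraph V) [DecidableRel G.Adj] (W₁ W₂ : ℕ → ℝ) (f : V → V)
    (L : ℝ) (n t : ℕ) (x : ℕ → Fin N → V) : ℝ :=
  if ∀ s, n ≤ s → s < t → IsNiceJump G f x s then
    Real.exp (-(potential G W₁ W₂ x t + L * ((∑ v, delay G f x t v : ℕ) : ℝ))) else 0

theorem adaptedAt_niceFactor (f : V → V) (L : ℝ) (n t : ℕ) :
    AdaptedAt t (niceFactor (N := N) G W₁ W₂ f L n t) := by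
  intro x x' h
  have h1 : potential G W₁ W₂ x t = potential G W₁ W₂ x' t := adaptedAt_potential G W₁ W₂ t _ _ h
  have h2 : ∀ v, delay G f x t v = delay G f x' t v := fun v => adaptedAt_delay G f t v _ _ h
  have h3 : (∀ s, n ≤ s → s < t → IsNiceJump G f x s) ↔
      (∀ s, n ≤ s → s < t → IsNiceJump G f x' s) := by
    refine forall_congr' fun s => forall₂_congr fun _ hst => iff_of_eq ?_
    exact adaptedAt_isNiceJump G f s _ _ fun m hm => h m (by omega)
  simp only [niceFactor, h1, h2]
  by_cases hp : ∀ s, n ≤ s → s < t → IsNiceJump G f x s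
  · rw [if_pos hp, if_pos (h3.mp hp)]
  · rw [if_neg hp, if_neg (fun hp' => hp (h3.mpr hp'))]

theorem niceFactor_nonneg (f : V → V) (L : ℝ) (n t : ℕ) (x : ℕ → Fin N → V) :
    0 ≤ niceFactor G W₁ W₂ f L n t x := by
  unfold niceFactor
  split_ifs <;> positivity

theorem isJump_jumpTo {x : ℕ → Fin N → V} {t : ℕ} (hx : ∀ m < t, IsJump G x m) (i : Fin N)
    (u : V) : ∀ m < t, IsJump G (jumpTo x t i u) m := by
  intro m hm
  have : IsJump G x m = IsJump G (jumpTo x t i u) m :=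
    adaptedAt_isJump G m _ _ fun k hk => (jumpTo_of_le x i u (by omega)).symm
  exact this ▸ hx m hm

theorem crossing_jumpTo (x : ℕ → Fin N → V) (t : ℕ) (i : Fin N) (u a b : V) :
    crossing (jumpTo x t i u) t a b = crossing x t a b :=
  adaptedAt_crossing t a b _ _ fun _ hm => jumpTo_of_le x i u hm

/-- If some walker is stuck, one prescribed jump, of probability at least `δ / N`, suffices because
the drop of the delay compensates for it. Otherwise every walker separately satisfies the
inequality: the drop of the potential compensates for the chance of a bad jump. -/
theorem niceFactor_le (hN : 1 ≤ N) (hW₁ : ∀ k, 0 < W₁ k) (hW₂ : ∀ k, 0 < W₂ k)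
    (hA2 : SummabilityCondition G.maxDegree N W₁ W₂) {f : V → V} (hf : ∀ v, G.Adj v (f v))
    (hff : ∀ v, f (f v) ≠ v) {K δ L : ℝ}
    (hK : ∀ (x : ℕ → Fin N → V) t, potential G W₁ W₂ x t ≤ K) (hδ : 0 < δ)
    (hδp : ∀ (x : ℕ → Fin N → V) (t : ℕ) (v u : V), (∀ m < t, IsJump G x m) →
      IsSink G x t v → G.Adj v u → δ ≤ jumpProb G W₁ W₂ x t v u)
    (hL : 0 ≤ L) (hLK : N / δ ≤ Real.exp (L - K)) (n t : ℕ) (hnt : n ≤ t) (x : ℕ → Fin N → V)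
    (hx : ∀ m < t, IsJump G x m) :
    niceFactor G W₁ W₂ f L n t x ≤ ∑ i : Fin N, (1 / (N : ℝ)) * ∑ u ∈ G.neighborFinset (x t i),
        jumpProb G W₁ W₂ x t (x t i) u * niceFactor G W₁ W₂ f L n (t + 1) (jumpTo x t i u) := by
  have hN0 : (0 : ℝ) < N := by exact_mod_cast hN
  have hterm : ∀ (i : Fin N) (u : V),
      0 ≤ jumpProb G W₁ W₂ x t (x t i) u * niceFactor G W₁ W₂ f L n (t + 1) (jumpTo x t i u) :=
    fun i u => mul_nonneg (jumpProb_nonneg G hW₁ hW₂ _ _ _ _) (niceFactor_nonneg _ _ _ _ _)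
  by_cases hnice : ∀ s, n ≤ s → s < t → IsNiceJump G f x s
  swap
  · rw [niceFactor, if_neg hnice]
    exact Finset.sum_nonneg fun i _ => mul_nonneg (by positivity)
      (Finset.sum_nonneg fun u _ => hterm i u)
  set U := potential G W₁ W₂ x t + L * ((∑ v, delay G f x t v : ℕ) : ℝ) with hU
  have hF : niceFactor G W₁ W₂ f L n t x = Real.exp (-U) := by rw [niceFactor, if_pos hnice]
  -- the factor after a nice jump
  have hnext : ∀ i u, IsNiceJump G f (jumpTo x t i u) t →
      niceFactor G W₁ W₂ f L n (t + 1) (jumpTo x t i u)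
        = Real.exp (-(potential G W₁ W₂ (jumpTo x t i u) (t + 1)
          + L * ((∑ v, delay G f (jumpTo x t i u) (t + 1) v : ℕ) : ℝ))) := by
    intro i u h
    rw [niceFactor, if_pos]
    intro s hns hst
    rcases Nat.lt_succ_iff_lt_or_eq.mp hst with hst | rfl
    · have : IsNiceJump G f x s = IsNiceJump G f (jumpTo x t i u) s :=
        adaptedAt_isNiceJump G f s _ _ fun k hk => (jumpTo_of_le x i u (by omega)).symm
      exact this ▸ hnice s hns hst
    · exact h
  have hpot : ∀ i u, potential G W₁ W₂ (jumpTo x t i u) t = potential G W₁ W₂ x t :=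
    fun i u => adaptedAt_potential G W₁ W₂ t _ _ fun m hm => jumpTo_of_le x i u hm
  have hdel : ∀ i u v, delay G f (jumpTo x t i u) t v = delay G f x t v :=
    fun i u v => adaptedAt_delay G f t v _ _ fun m hm => jumpTo_of_le x i u hm
  have hsink : ∀ i u v, IsSink G (jumpTo x t i u) t v = IsSink G x t v :=
    fun i u v => adaptedAt_isSink G t v _ _ fun m hm => jumpTo_of_le x i u hm
  have hstuck : ∀ i u, Stuck G (jumpTo x t i u) t = Stuck G x t :=
    fun i u => adaptedAt_stuck G t _ _ fun m hm => jumpTo_of_le x i u hm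
  have hpos : ∀ i u, jumpTo x t i u t = x t := fun i u => jumpTo_of_le x i u le_rfl
  rw [hF]
  by_cases hst : Stuck G x t
  · obtain ⟨i, hi⟩ := hst
    set z := jumpTo x t i (f (x t i)) with hz
    have hi' : IsSink G z t (z t i) := by rw [hz, hsink, hpos]; exact hi
    have hzt : z (t + 1) = Function.update (z t) i (f (z t i)) := by
      rw [hz, jumpTo_succ, hpos]
    have hd := sum_delay_of_sink hf hff (isJump_jumpTo hx i _) hi' hzt
    rw [← hz] at hd
    have hd' : ∑ v, delay G f z t v = ∑ v, delay G f x t v := Finset.sum_congr rfl fun v _ => hdel _ _ v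
    rw [hd'] at hd
    -- The delay term gains at least `L`, while the potential may rise by at most `K`, since it
    -- takes values in `[0, K]`.
    have hfac : Real.exp (-U) * (N / δ) ≤ niceFactor G W₁ W₂ f L n (t + 1) z := by
      rw [hz, hnext i _ (Or.inl ⟨i, hi', hzt⟩), ← hz]
      refine (mul_le_mul_of_nonneg_left hLK (Real.exp_pos _).le).trans ?_
      rw [← Real.exp_add, Real.exp_le_exp]
      have h1 := hK z (t + 1)
      have h2 := potential_nonneg G W₁ W₂ x t
      have h3 : L * (((∑ v, delay G f z (t + 1) v : ℕ) : ℝ) + 1)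
          ≤ L * ((∑ v, delay G f x t v : ℕ) : ℝ) := by
        gcongr
        exact_mod_cast hd
      rw [hU]
      linarith
    calc Real.exp (-U) = (1 / N) * (δ * (Real.exp (-U) * (N / δ))) := by field_simp
      _ ≤ (1 / N) * (jumpProb G W₁ W₂ x t (x t i) (f (x t i))
            * niceFactor G W₁ W₂ f L n (t + 1) z) := by
          gcongr
          · exact jumpProb_nonneg G hW₁ hW₂ _ _ _ _
          · exact hδp x t _ _ hx hi (hf _)
      _ ≤ (1 / N) * ∑ u ∈ G.neighborFinset (x t i), jumpProb G W₁ W₂ x t (x t i) u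
            * niceFactor G W₁ W₂ f L n (t + 1) (jumpTo x t i u) := by
          gcongr
          exact Finset.single_le_sum (f := fun u => jumpProb G W₁ W₂ x t (x t i) u
            * niceFactor G W₁ W₂ f L n (t + 1) (jumpTo x t i u)) (fun u _ => hterm i u)
            ((G.mem_neighborFinset _ _).mpr (hf _))
      _ ≤ _ := Finset.single_le_sum (f := fun i : Fin N => (1 / (N : ℝ)) *
            ∑ u ∈ G.neighborFinset (x t i), jumpProb G W₁ W₂ x t (x t i) u
            * niceFactor G W₁ W₂ f L n (t + 1) (jumpTo x t i u))
            (fun i _ => mul_nonneg (by positivity) (Finset.sum_nonneg fun u _ => hterm i u))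
            (Finset.mem_univ i)
  · have hwalker : ∀ i : Fin N, Real.exp (-U) ≤ ∑ u ∈ G.neighborFinset (x t i),
        jumpProb G W₁ W₂ x t (x t i) u
          * niceFactor G W₁ W₂ f L n (t + 1) (jumpTo x t i u) := by
      intro i
      have hex : ∃ u, G.Adj (x t i) u ∧ 0 < crossing x t (x t i) u := by
        by_contra! h
        exact hst ⟨i, h⟩
      have h1 := one_le_sum_jumpProb_mul_exp (G := G) hW₁ hW₂ hex
      calc Real.exp (-U) ≤ Real.exp (-U) * _ := le_mul_of_one_le_right (Real.exp_pos _).le h1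
        _ = ∑ u ∈ G.neighborFinset (x t i) with 0 < crossing x t (x t i) u,
            jumpProb G W₁ W₂ x t (x t i) u *
              Real.exp (-(U - ratio W₁ W₂ (localCrossing G x t (x t i)))) := by
          rw [Finset.mul_sum]
          refine Finset.sum_congr rfl fun u _ => ?_
          rw [neg_sub, sub_eq_add_neg, Real.exp_add]
          ring
        _ ≤ ∑ u ∈ G.neighborFinset (x t i) with 0 < crossing x t (x t i) u,
            jumpProb G W₁ W₂ x t (x t i) u
              * niceFactor G W₁ W₂ f L n (t + 1) (jumpTo x t i u) := by
          refine Finset.sum_le_sum fun u hu => ?_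
          obtain ⟨hu, hc⟩ := Finset.mem_filter.mp hu
          rw [G.mem_neighborFinset] at hu
          gcongr
          · exact jumpProb_nonneg G hW₁ hW₂ _ _ _ _
          set z := jumpTo x t i u with hz
          have hzi : z t i = x t i := by rw [hz, hpos]
          have hzadj : G.Adj (z t i) u := by rwa [hzi]
          have hzc : 0 < crossing z t (z t i) u := by rwa [hzi, hz, crossing_jumpTo]
          have hzt : z (t + 1) = Function.update (z t) i u := jumpTo_succ x t i u
          have hzn : ¬ Stuck G z t := by rwa [hz, hstuck]
          have hzg : IsGoodJump G z t := ⟨i, u, hzadj, hzc, hzt⟩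
          have hzl : ∀ m < t, IsJump G z m := isJump_jumpTo hx i u
          rw [hz, hnext i u (Or.inr ⟨hzn, hzg⟩), ← hz]
          rw [Real.exp_le_exp, neg_le_neg_iff]
          have h2 := potential_add_ratio_le hA2 hW₁ hW₂ hzl hzadj hzc hzt
          have h3 : ∀ v, localCrossing G z t v = localCrossing G x t v := fun v =>
            adaptedAt_localCrossing G t v _ _ fun m hm => jumpTo_of_le x i u hm
          rw [hzi, h3] at h2
          have h4 : potential G W₁ W₂ z t = potential G W₁ W₂ x t := hpot i u
          have h5 := sum_delay_of_good hf hzl hzn hzg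
          have h6 : ∑ v, delay G f z t v = ∑ v, delay G f x t v :=
            Finset.sum_congr rfl fun v _ => hdel _ _ v
          have h7 : L * ((∑ v, delay G f z (t + 1) v : ℕ) : ℝ)
              ≤ L * ((∑ v, delay G f x t v : ℕ) : ℝ) := by
            refine mul_le_mul_of_nonneg_left ?_ hL
            rw [← h6]
            exact_mod_cast h5
          rw [hU]
          linarith
        _ ≤ _ := Finset.sum_le_sum_of_subset_of_nonneg (Finset.filter_subset _ _)
            fun u _ _ => hterm i u
    calc Real.exp (-U) = ∑ _i : Fin N, (1 / (N : ℝ)) * Real.exp (-U) := by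
          simp
          field_simp
      _ ≤ _ := by
          refine Finset.sum_le_sum fun i _ => ?_
          gcongr
          exact hwalker i

variable [MeasurableSpace V] [MeasurableSingletonClass V] {μ : Measure (ℕ → Fin N → V)}

theorem IsAntLaw.ae_isJump (hμ : IsAntLaw G W₁ W₂ μ) : ∀ᵐ x ∂μ, ∀ m, IsJump G x m := by
  have := hμ.prob
  rw [ae_all_iff]
  intro m
  have hB : MeasurableSet {x : ℕ → Fin N → V | ¬ IsJump G x m} :=
    (adaptedAt_isJump G m).measurableSet.compl
  refine ae_iff.mpr (measure_eq_zero_of_cyl_bound hB zero_lt_one (m + 1) fun n hn x => ?_)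
  rw [zero_mul]
  by_cases h0 : μ.real (cyl n x) = 0
  · exact (measureReal_mono Set.inter_subset_right).trans h0.le
  · have hx := hμ.isJump_of_cyl h0 m (by omega)
    have : {x : ℕ → Fin N → V | ¬ IsJump G x m} ∩ cyl n x = ∅ := by
      ext z
      simp only [Set.mem_inter_iff, Set.mem_empty_iff_false, iff_false, not_and]
      intro hz hzn
      have : IsJump G z m = IsJump G x m :=
        adaptedAt_isJump G m _ _ fun k hk => hzn k (by omega)
      exact hz (this ▸ hx)
    rw [this]
    simp

/-- Almost surely all jumps from some time on have positive crossing number. -/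
theorem IsAntLaw.ae_eventually_isGoodJump (hμ : IsAntLaw G W₁ W₂ μ) (hconn : G.Connected)
    (hcircuit : ¬ G.IsAcyclic) (hN : 1 ≤ N) (hW₁ : ∀ k, 0 < W₁ k) (hW₂ : ∀ k, 0 < W₂ k)
    (hA2 : SummabilityCondition G.maxDegree N W₁ W₂) :
    ∀ᵐ x ∂μ, ∃ m, ∀ t, m ≤ t → IsGoodJump G x t := by
  have := hμ.prob
  obtain ⟨f, hf, hff⟩ := exists_escape hconn hcircuit
  obtain ⟨K, hK⟩ := exists_potential_le (N := N) hA2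
  obtain ⟨δ, hδ, hδp⟩ := exists_le_jumpProb_of_sink (N := N) (G := G) W₁ hW₂
  have hN0 : (0 : ℝ) < N := by exact_mod_cast hN
  -- The absolute values make `L` nonnegative and at least `K + log (N / δ)`.
  set L := |K| + |Real.log (N / δ)|
  have hL : 0 ≤ L := by positivity
  have hLK : N / δ ≤ Real.exp (L - K) := by
    rw [← Real.log_le_iff_le_exp (by positivity)]
    have := le_abs_self K
    have := le_abs_self (Real.log (N / δ))
    simp only [L]
    linarith
  -- The smallest possible initial value of `niceFactor`: potential at most `K`, delay at most `N +
  -- 1` at each vertex. It depends neither on the time nor on the past.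
  set p := Real.exp (-(K + L * (Fintype.card V * (N + 1) : ℕ)))
  have hp : 0 < p := Real.exp_pos _
  have hmeas : MeasurableSet {x : ℕ → Fin N → V | ∃ m, ∀ t, m ≤ t → IsGoodJump G x t} := by
    have : {x : ℕ → Fin N → V | ∃ m, ∀ t, m ≤ t → IsGoodJump G x t}
        = ⋃ m, ⋂ t, ⋂ (_ : m ≤ t), {x | IsGoodJump G x t} := by
      ext; simp
    rw [this]
    exact MeasurableSet.iUnion fun m => MeasurableSet.iInter fun t => MeasurableSet.iInter fun _ =>
      (adaptedAt_isGoodJump G t).measurableSet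
  refine measure_eq_zero_of_cyl_bound hmeas.compl (show 1 - p < 1 by linarith) 0 ?_
  intro n _ x
  by_cases h0 : μ.real (cyl n x) = 0
  · rw [h0, mul_zero]
    exact (measureReal_mono Set.inter_subset_right).trans h0.le
  have hx := hμ.isJump_of_cyl h0
  set E : ℕ → Set (ℕ → Fin N → V) := fun T => {z | ∀ s, n ≤ s → s < T → IsNiceJump G f z s}
  have hEm : ∀ T, MeasurableSet (E T) := by
    intro T
    have : E T = ⋂ s, ⋂ (_ : n ≤ s), ⋂ (_ : s < T), {z | IsNiceJump G f z s} := by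
      ext; simp [E]
    rw [this]
    exact MeasurableSet.iInter fun s => MeasurableSet.iInter fun _ => MeasurableSet.iInter fun _ =>
      (adaptedAt_isNiceJump G f s).measurableSet
  have hET : ∀ T, n ≤ T → p * μ.real (cyl n x) ≤ μ.real (cyl n x ∩ E T) := by
    intro T hT
    have h1 := hμ.le_integral (fun t _ => adaptedAt_niceFactor (G := G) (W₁ := W₁) (W₂ := W₂) f L n t)
      hT (fun t ht _ x hx => niceFactor_le hN hW₁ hW₂ hA2 hf hff hK hδ hδp hL hLK n t ht x hx) x
    have h2 : p ≤ niceFactor G W₁ W₂ f L n n x := by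
      rw [niceFactor, if_pos (by intros; omega), Real.exp_le_exp, neg_le_neg_iff]
      have := hK x n
      have h3 : ∑ v, delay G f x n v ≤ Fintype.card V * (N + 1) :=
        (Finset.sum_le_card_nsmul _ _ _ fun v _ => delay_le hf hx v).trans (by simp)
      gcongr
    have h3 : ∫ z in cyl n x, niceFactor G W₁ W₂ f L n T z ∂μ
        ≤ ∫ z in cyl n x, (E T).indicator (fun _ => (1 : ℝ)) z ∂μ := by
      refine setIntegral_mono (adaptedAt_niceFactor f L n T).integrable.integrableOn
        ((integrable_const _).indicator (hEm T)).integrableOn fun z => ?_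
      by_cases hz : z ∈ E T
      · rw [Set.indicator_of_mem hz]
        unfold niceFactor
        split_ifs
        · rw [Real.exp_le_one_iff]
          have := potential_nonneg G W₁ W₂ z T
          have : 0 ≤ L * ((∑ v, delay G f z T v : ℕ) : ℝ) := by positivity
          linarith
        · exact zero_le_one
      · rw [Set.indicator_of_notMem hz]
        exact (if_neg hz).le
    rw [integral_indicator_const _ (hEm T), smul_eq_mul, mul_one,
      measureReal_restrict_apply (hEm T), Set.inter_comm] at h3
    calc p * μ.real (cyl n x) ≤ μ.real (cyl n x) * niceFactor G W₁ W₂ f L n n x := by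
          rw [mul_comm]
          gcongr
      _ ≤ _ := h1.trans h3
  have hanti : Antitone fun T => cyl n x ∩ E T := fun T T' hTT z hz =>
    ⟨hz.1, fun s hs hsT => hz.2 s hs (hsT.trans_le hTT)⟩
  have hlim : Tendsto (fun T => μ.real (cyl n x ∩ E T)) atTop
      (nhds (μ.real (⋂ T, cyl n x ∩ E T))) := by
    refine (ENNReal.tendsto_toReal (measure_ne_top _ _)).comp (tendsto_measure_iInter_atTop
      (fun T => ((measurableSet_cyl n x).inter (hEm T)).nullMeasurableSet) hanti
      ⟨0, measure_ne_top _ _⟩)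
  have hinf : p * μ.real (cyl n x) ≤ μ.real (⋂ T, cyl n x ∩ E T) :=
    ge_of_tendsto hlim (eventually_atTop.mpr ⟨n, fun T hT => hET T hT⟩)
  have hsub : (⋂ T, cyl n x ∩ E T)
      ⊆ {x : ℕ → Fin N → V | ∃ m, ∀ t, m ≤ t → IsGoodJump G x t} ∩ cyl n x := by
    intro z hz
    rw [Set.mem_iInter] at hz
    refine ⟨?_, (hz 0).1⟩
    have hnice : ∀ s, n ≤ s → IsNiceJump G f z s := fun s hs => (hz (s + 1)).2 s hs (by omega)
    have hjump : ∀ m, IsJump G z m := by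
      intro m
      by_cases hm : m < n
      · have : IsJump G z m = IsJump G x m :=
          adaptedAt_isJump G m _ _ fun k hk => (hz 0).1 k (by omega)
        exact this ▸ hx m hm
      · exact (hnice m (by omega)).isJump hf
    -- Along nice jumps the total delay is a nonincreasing natural number that drops at every jump
    -- of a stuck walker, so such jumps stop and good ones remain.
    set d : ℕ → ℕ := fun t => ∑ v, delay G f z (n + t) v
    have hd : Antitone d := by
      refine antitone_nat_of_succ_le fun t => ?_
      rcases hnice (n + t) (by omega) with ⟨i, hi, hzt⟩ | ⟨hns, hg⟩
      · have := sum_delay_of_sink hf hff (fun m _ => hjump m) hi hzt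
        exact (Nat.le_succ _).trans this
      · exact sum_delay_of_good hf (fun m _ => hjump m) hns hg
    obtain ⟨m, hm⟩ : ∃ m, ∀ t, m ≤ t → d t = d m := by
      obtain ⟨m, hm⟩ := (wellFounded_lt.has_min (Set.range d) ⟨_, 0, rfl⟩)
      obtain ⟨⟨m, rfl⟩, hm⟩ := hm.imp id id
      exact ⟨m, fun t ht => le_antisymm (hd ht) (not_lt.mp (hm _ ⟨t, rfl⟩))⟩
    refine ⟨n + m, fun t ht => ?_⟩
    obtain ⟨k, rfl⟩ := Nat.exists_eq_add_of_le ht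
    rcases hnice (n + m + k) (by omega) with ⟨i, hi, hzt⟩ | ⟨-, hg⟩
    · have h1 := sum_delay_of_sink hf hff (fun m _ => hjump m) hi hzt
      have h2 := hm (m + k) (by omega)
      have h3 := hm (m + k + 1) (by omega)
      simp only [d, ← add_assoc] at h2 h3
      omega
    · exact hg
  have hge : p * μ.real (cyl n x)
      ≤ μ.real ({x : ℕ → Fin N → V | ∃ m, ∀ t, m ≤ t → IsGoodJump G x t} ∩ cyl n x) :=
    hinf.trans (measureReal_mono hsub)
  have hsplit := measureReal_inter_add_sdiff (μ := μ) (s := cyl n x) hmeas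
  rw [Set.inter_comm] at hge
  rw [Set.inter_comm, ← Set.sdiff_eq]
  linarith

end EventuallyGood

end AntRW

namespace AntRW

/-! ### A moment inequality for the competition of two edges. -/

section TailSums

/-- The tail sums of a real sequence. -/
noncomputable def tail (p : ℕ → ℝ) (k : ℕ) : ℝ := ∑' j, p (j + k)

theorem tail_eq {p : ℕ → ℝ} (hp : Summable p) (k : ℕ) : tail p k = p k + tail p (k + 1) := by
  have h := ((summable_nat_add_iff k).mpr hp).tsum_eq_zero_add
  rw [tail, h, zero_add]
  congr 1
  exact tsum_congr fun j => by rw [add_right_comm, add_assoc]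

theorem tail_nonneg {p : ℕ → ℝ} (hp : ∀ k, 0 ≤ p k) (k : ℕ) : 0 ≤ tail p k :=
  tsum_nonneg fun _ => hp _

theorem tendsto_tail (p : ℕ → ℝ) : Tendsto (tail p) atTop (nhds 0) := tendsto_sum_nat_add p

theorem summable_sq {p : ℕ → ℝ} (h0 : ∀ k, 0 ≤ p k) (hp : Summable p) :
    Summable fun k => p k ^ 2 := by
  refine Summable.of_nonneg_of_le (fun k => sq_nonneg _) (fun k => ?_) (hp.mul_left (∑' j, p j))
  rw [sq]
  exact mul_le_mul_of_nonneg_right (hp.le_tsum k fun j _ => h0 j) (h0 k)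

/-- The test function for the competition of two edges, `D` being the difference and `Q` the
quadratic variation still to come. -/
def testFun (θ D Q : ℝ) : ℝ :=
  2 * θ * (D ^ 2 + Q) - θ ^ 2 * (D ^ 4 + 8 * D ^ 2 * Q + 19 * Q ^ 2)

/-- A Paley–Zygmund argument in pointwise form: `2 * θ * Z - θ ^ 2 * Z ^ 2 ≤ 1` with equality to `0`
at `Z = 0`. Here `D ^ 2 + Q` stands for the expected final value of `Z = D ^ 2`, and the quartic
polynomial dominates its second moment. -/
theorem testFun_le_one (θ D : ℝ) {Q : ℝ} (hQ : 0 ≤ Q) : testFun θ D Q ≤ 1 := by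
  have h : 1 - testFun θ D Q = (1 - θ * (D ^ 2 + Q)) ^ 2
      + θ ^ 2 * (6 * D ^ 2 * Q + 18 * Q ^ 2) := by rw [testFun]; ring
  have : 0 ≤ 1 - testFun θ D Q := by rw [h]; positivity
  linarith

/-- The quartic polynomial is at most `19 * (D ^ 2 + Q) ^ 2`, so this `θ` yields at least `2 / 19 -
1 / 19`. -/
theorem le_testFun (D : ℝ) {Q : ℝ} (hQ : 0 < Q) :
    1 / 19 ≤ testFun (1 / (19 * (D ^ 2 + Q))) D Q := by
  have hM : 0 < D ^ 2 + Q := by positivity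
  have h : testFun (1 / (19 * (D ^ 2 + Q))) D Q - 1 / 19
      = (18 * D ^ 4 + 30 * D ^ 2 * Q) / (361 * (D ^ 2 + Q) ^ 2) := by
    rw [testFun]
    field_simp
    ring
  have : 0 ≤ testFun (1 / (19 * (D ^ 2 + Q))) D Q - 1 / 19 := by rw [h]; positivity
  linarith

/-- The coefficients `8` and `19` leave a remainder that is visibly nonnegative after the part
linear in `d` is removed; the linear part cancels in the mean. -/
theorem testFun_step (θ D : ℝ) {Q d : ℝ} (hd : d ^ 2 ≤ Q) :
    d * (4 * θ * D - θ ^ 2 * (4 * D ^ 3 + 16 * D * Q))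
      ≤ testFun θ (D + d) (Q - d ^ 2) - testFun θ D Q := by
  have h : testFun θ (D + d) (Q - d ^ 2) - testFun θ D Q
      - d * (4 * θ * D - θ ^ 2 * (4 * D ^ 3 + 16 * D * Q))
      = θ ^ 2 * (2 * (D + 3 * d) ^ 2 * d ^ 2 + 30 * d ^ 2 * (Q - d ^ 2)) := by
    simp only [testFun]
    ring
  have hQ : 0 ≤ Q - d ^ 2 := by linarith
  have : 0 ≤ θ ^ 2 * (2 * (D + 3 * d) ^ 2 * d ^ 2 + 30 * d ^ 2 * (Q - d ^ 2)) := by positivity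
  linarith

/-- The test function does not decrease in mean if the jumps `-p⁻¹` and `q⁻¹` have weights `p` and
`q`. -/
theorem testFun_balance (θ D : ℝ) {Q p q : ℝ} (hp : 0 < p) (hq : 0 < q)
    (hpQ : p⁻¹ ^ 2 ≤ Q) (hqQ : q⁻¹ ^ 2 ≤ Q) :
    0 ≤ p * (testFun θ (D - p⁻¹) (Q - p⁻¹ ^ 2) - testFun θ D Q)
      + q * (testFun θ (D + q⁻¹) (Q - q⁻¹ ^ 2) - testFun θ D Q) := by
  have h1 := testFun_step θ D (Q := Q) (d := -p⁻¹) (by rwa [neg_sq])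
  have h2 := testFun_step θ D hqQ
  rw [neg_sq, ← sub_eq_add_neg] at h1
  have h3 := mul_le_mul_of_nonneg_left h1 hp.le
  have h4 := mul_le_mul_of_nonneg_left h2 hq.le
  have h5 : p * (-p⁻¹ * (4 * θ * D - θ ^ 2 * (4 * D ^ 3 + 16 * D * Q)))
      + q * (q⁻¹ * (4 * θ * D - θ ^ 2 * (4 * D ^ 3 + 16 * D * Q))) = 0 := by
    field_simp
    simp
  linarith

end TailSums

/-! ### The competition of two outgoing edges as a submartingale. -/

section Fixation

set_option linter.unusedSectionVars false

variable {V : Type*} [Fintype V] [DecidableEq V] {G : SimpleGraph V} [DecidableRel G.Adj]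
  {N : ℕ} {W₁ W₂ : ℕ → ℝ}

/-- From time `m` to time `t` the crossing numbers of `(v, a)` and `(v, b)` are positive and do not
decrease. -/
def Competing (m t : ℕ) (v a b : V) (x : ℕ → Fin N → V) : Prop :=
  (0 < crossing x m v a ∧ 0 < crossing x m v b) ∧ ∀ s, m ≤ s → s < t →
    crossing x s v a ≤ crossing x (s + 1) v a ∧ crossing x s v b ≤ crossing x (s + 1) v b

theorem Competing.mono {m s t : ℕ} {v a b : V} {x : ℕ → Fin N → V} (h : Competing m t v a b x)
    (hst : s ≤ t) : Competing m s v a b x :=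
  ⟨h.1, fun r hmr hrs => h.2 r hmr (hrs.trans_le hst)⟩

theorem Competing.crossing_le {m t : ℕ} {v a b : V} {x : ℕ → Fin N → V}
    (h : Competing m t v a b x) {s r : ℕ} (hs : m ≤ s) (hsr : s ≤ r) (hr : r ≤ t) :
    crossing x s v a ≤ crossing x r v a ∧ crossing x s v b ≤ crossing x r v b := by
  induction r, hsr using Nat.le_induction with
  | base => exact ⟨le_rfl, le_rfl⟩
  | succ r hsr ih =>
    have h1 := ih (by omega)
    have h2 := h.2 r (by omega) (by omega)
    exact ⟨h1.1.trans h2.1, h1.2.trans h2.2⟩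

theorem adaptedAt_competing {m t : ℕ} (hmt : m ≤ t) (v a b : V) :
    AdaptedAt t (Competing (N := N) m t v a b) := by
  intro x x' h
  have hc : ∀ s ≤ t, ∀ a b, crossing x s a b = crossing x' s a b :=
    fun s hs a b => adaptedAt_crossing s a b _ _ fun k hk => h k (hk.trans hs)
  have h3 : (∀ s, m ≤ s → s < t →
      crossing x s v a ≤ crossing x (s + 1) v a ∧ crossing x s v b ≤ crossing x (s + 1) v b) =
      (∀ s, m ≤ s → s < t →
      crossing x' s v a ≤ crossing x' (s + 1) v a ∧ crossing x' s v b ≤ crossing x' (s + 1) v b) := by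
    refine propext (forall₂_congr fun s _ => forall_congr' fun hst => ?_)
    rw [hc s (by omega), hc s (by omega), hc (s + 1) (by omega), hc (s + 1) (by omega)]
  simp only [Competing, hc m hmt, h3]

open Classical in
/-- The test function evaluated along the competition of the edges `(v, a)` and `(v, b)`; it is
replaced by its upper bound as soon as one of the crossing numbers decreases. -/
noncomputable def competition (W₁ : ℕ → ℝ) (θ : ℝ) (m : ℕ) (v a b : V) (t : ℕ)
    (x : ℕ → Fin N → V) : ℝ :=
  if Competing m t v a b x then
    testFun θ (tail (fun k => (W₁ k)⁻¹) (crossing x t v a).toNat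
        - tail (fun k => (W₁ k)⁻¹) (crossing x t v b).toNat)
      (tail (fun k => (W₁ k)⁻¹ ^ 2) (crossing x t v a).toNat
        + tail (fun k => (W₁ k)⁻¹ ^ 2) (crossing x t v b).toNat)
  else 1

theorem competition_le_one (θ : ℝ) (m : ℕ) (v a b : V) (t : ℕ) (x : ℕ → Fin N → V) :
    competition W₁ θ m v a b t x ≤ 1 := by
  unfold competition
  split_ifs
  · exact testFun_le_one _ _ (add_nonneg (tail_nonneg (fun k => sq_nonneg _) _)
      (tail_nonneg (fun k => sq_nonneg _) _))
  · exact le_rfl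

/-- A jump along neither `(v, a)` nor `(v, b)` leaves the value unchanged or, by lowering a crossing
number, lifts it to the upper bound `1`. For the two remaining jumps, the tail at level `k` loses `1
/ W₁ k` with weight `W₁ k`, so both push the difference equally in opposite directions. -/
theorem competition_le_sum (hW₁ : ∀ k, 0 < W₁ k) (hW₂ : ∀ k, 0 < W₂ k)
    (hsum : Summable fun k => (W₁ k)⁻¹) (hdeg : ∀ v, ∃ u, G.Adj v u)
    (θ : ℝ) {m t : ℕ} (hmt : m ≤ t) {v a b : V} (ha : G.Adj v a) (hb : G.Adj v b) (hab : a ≠ b)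
    (x : ℕ → Fin N → V) (i : Fin N) :
    competition W₁ θ m v a b t x ≤ ∑ u ∈ G.neighborFinset (x t i),
      jumpProb G W₁ W₂ x t (x t i) u * competition W₁ θ m v a b (t + 1) (jumpTo x t i u) := by
  have hJ : ∀ u, Competing m (t + 1) v a b (jumpTo x t i u) → Competing m t v a b x := by
    intro u h
    have e : Competing m t v a b (jumpTo x t i u) = Competing m t v a b x :=
      adaptedAt_competing hmt v a b _ _ fun k hk => jumpTo_of_le x i u hk
    exact e ▸ h.mono (Nat.le_succ t)
  have hone := sum_jumpProb G hW₁ hW₂ x t (hdeg (x t i))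
  by_cases hC : Competing m t v a b x
  swap
  · have h1 : ∀ u, competition W₁ θ m v a b (t + 1) (jumpTo x t i u) = 1 := fun u => by
      rw [competition, if_neg]
      exact fun h => hC (hJ u h)
    simp only [h1, mul_one, hone]
    exact competition_le_one _ _ _ _ _ _ _
  set y := competition W₁ θ m v a b t x with hy
  have hcs : ∀ u c, crossing (jumpTo x t i u) (t + 1) v c = crossing x t v c
      + ((if x t i = v ∧ u = c then 1 else 0) - (if x t i = c ∧ u = v then 1 else 0)) := by
    intro u c
    have := crossing_succ (jumpTo_succ x t i u) v c
    rwa [crossing_jumpTo, jumpTo_of_le x i u le_rfl] at this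
  have hCnext : ∀ u, Competing m (t + 1) v a b (jumpTo x t i u) ↔
      crossing x t v a ≤ crossing (jumpTo x t i u) (t + 1) v a ∧
      crossing x t v b ≤ crossing (jumpTo x t i u) (t + 1) v b := by
    intro u
    constructor
    · intro h
      have := h.2 t hmt (by omega)
      rwa [crossing_jumpTo, crossing_jumpTo] at this
    · intro h
      have e : Competing m t v a b (jumpTo x t i u) = Competing m t v a b x :=
        adaptedAt_competing hmt v a b _ _ fun k hk => jumpTo_of_le x i u hk
      have hC' : Competing m t v a b (jumpTo x t i u) := e ▸ hC
      refine ⟨hC'.1, fun s hs hst => ?_⟩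
      rcases Nat.lt_succ_iff_lt_or_eq.mp hst with hst | rfl
      · exact hC'.2 s hs hst
      · rwa [crossing_jumpTo, crossing_jumpTo]
  have hother : ∀ u, ¬ (x t i = v ∧ u = a) → ¬ (x t i = v ∧ u = b) →
      y ≤ competition W₁ θ m v a b (t + 1) (jumpTo x t i u) := by
    intro u hua hub
    by_cases hn : Competing m (t + 1) v a b (jumpTo x t i u)
    · have h1 := (hCnext u).mp hn
      have h2 := hcs u a
      have h3 := hcs u b
      rw [if_neg hua] at h2
      rw [if_neg hub] at h3
      have h4 : crossing (jumpTo x t i u) (t + 1) v a = crossing x t v a := by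
        split_ifs at h2 <;> omega
      have h5 : crossing (jumpTo x t i u) (t + 1) v b = crossing x t v b := by
        split_ifs at h3 <;> omega
      rw [hy, competition, competition, if_pos hC,
        if_pos hn, h4, h5]
    · have h1 : competition W₁ θ m v a b (t + 1) (jumpTo x t i u) = 1 := by
        rw [competition, if_neg]
        exact hn
      rw [h1]
      exact competition_le_one _ _ _ _ _ _ _
  have hprob : ∀ u, 0 ≤ jumpProb G W₁ W₂ x t (x t i) u := fun u => jumpProb_nonneg G hW₁ hW₂ _ _ _ _
  suffices h : 0 ≤ ∑ u ∈ G.neighborFinset (x t i), jumpProb G W₁ W₂ x t (x t i) u *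
      (competition W₁ θ m v a b (t + 1) (jumpTo x t i u) - y) by
    simp only [mul_sub, Finset.sum_sub_distrib, ← Finset.sum_mul, hone, one_mul] at h
    linarith
  by_cases hi : x t i = v
  swap
  · exact Finset.sum_nonneg fun u _ => mul_nonneg (hprob u) (sub_nonneg.mpr
      (hother u (fun h => hi h.1) (fun h => hi h.1)))
  have hsub : ({a, b} : Finset V) ⊆ G.neighborFinset (x t i) := by
    rw [hi]
    intro w hw
    rw [G.mem_neighborFinset]
    rcases Finset.mem_insert.mp hw with rfl | hw
    · exact ha
    · exact Finset.mem_singleton.mp hw ▸ hb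
  refine le_trans ?_ (Finset.sum_le_sum_of_subset_of_nonneg hsub fun u _ hu =>
    mul_nonneg (hprob u) (sub_nonneg.mpr (hother u (fun h => hu (by simp [h.2]))
      (fun h => hu (by simp [h.2])))))
  rw [Finset.sum_pair hab]
  have hca : 0 < crossing x t v a := hC.1.1.trans_le (hC.crossing_le le_rfl hmt le_rfl).1
  have hcb : 0 < crossing x t v b := hC.1.2.trans_le (hC.crossing_le le_rfl hmt le_rfl).2
  obtain ⟨α, hα⟩ := Int.eq_ofNat_of_zero_le hca.le
  obtain ⟨β, hβ⟩ := Int.eq_ofNat_of_zero_le hcb.le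
  set p : ℕ → ℝ := fun k => (W₁ k)⁻¹ with hp
  set q : ℕ → ℝ := fun k => (W₁ k)⁻¹ ^ 2 with hq
  have hp0 : ∀ k, 0 ≤ p k := fun k => (inv_pos.mpr (hW₁ k)).le
  have hqs : Summable q := summable_sq hp0 hsum
  have hq0 : ∀ k, 0 ≤ q k := fun k => sq_nonneg _
  have hy' : y = testFun θ (tail p α - tail p β) (tail q α + tail q β) := by
    rw [hy, competition, if_pos hC, hα, hβ]
    rfl
  have hya : competition W₁ θ m v a b (t + 1) (jumpTo x t i a)
      = testFun θ (tail p α - tail p β - (W₁ α)⁻¹) (tail q α + tail q β - (W₁ α)⁻¹ ^ 2) := by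
    have h1 := hcs a a
    have h2 := hcs a b
    rw [if_pos ⟨hi, rfl⟩, if_neg (fun h => ha.ne h.2.symm)] at h1
    rw [if_neg (fun h => hab h.2), if_neg (fun h => ha.ne h.2.symm)] at h2
    have hn := (hCnext a).mpr ⟨by omega, by omega⟩
    have h3 : crossing (jumpTo x t i a) (t + 1) v a = ((α + 1 : ℕ) : ℤ) := by push_cast; omega
    have h4 : crossing (jumpTo x t i a) (t + 1) v b = (β : ℤ) := by omega
    rw [competition, if_pos hn, h3, h4, Int.toNat_natCast,
      Int.toNat_natCast, ← hp, ← hq, tail_eq hsum α, tail_eq hqs α]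
    congr 1 <;> simp only [hp, hq] <;> ring
  have hyb : competition W₁ θ m v a b (t + 1) (jumpTo x t i b)
      = testFun θ (tail p α - tail p β + (W₁ β)⁻¹) (tail q α + tail q β - (W₁ β)⁻¹ ^ 2) := by
    have h1 := hcs b b
    have h2 := hcs b a
    rw [if_pos ⟨hi, rfl⟩, if_neg (fun h => hb.ne h.2.symm)] at h1
    rw [if_neg (fun h => hab h.2.symm), if_neg (fun h => hb.ne h.2.symm)] at h2
    have hn := (hCnext b).mpr ⟨by omega, by omega⟩
    have h3 : crossing (jumpTo x t i b) (t + 1) v b = ((β + 1 : ℕ) : ℤ) := by push_cast; omega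
    have h4 : crossing (jumpTo x t i b) (t + 1) v a = (α : ℤ) := by omega
    rw [competition, if_pos hn, h3, h4, Int.toNat_natCast,
      Int.toNat_natCast, ← hp, ← hq, tail_eq hsum β, tail_eq hqs β]
    congr 1 <;> simp only [hp, hq] <;> ring
  have hqα : (W₁ α)⁻¹ ^ 2 ≤ tail q α + tail q β := by
    rw [tail_eq hqs α]
    have := tail_nonneg hq0 (α + 1)
    have := tail_nonneg hq0 β
    simp only [hq] at *
    linarith
  have hqβ : (W₁ β)⁻¹ ^ 2 ≤ tail q α + tail q β := by
    rw [tail_eq hqs β]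
    have := tail_nonneg hq0 (β + 1)
    have := tail_nonneg hq0 α
    simp only [hq] at *
    linarith
  have key := testFun_balance θ (tail p α - tail p β) (hW₁ α) (hW₁ β) hqα hqβ
  rw [← hya, ← hyb, ← hy'] at key
  have hwa : weight W₁ W₂ (crossing x t v a) = W₁ α := by
    rw [weight, if_pos hca, hα]
    rfl
  have hwb : weight W₁ W₂ (crossing x t v b) = W₁ β := by
    rw [weight, if_pos hcb, hβ]
    rfl
  rw [hi]
  simp only [jumpProb, hwa, hwb]
  have hZ : 0 ≤ ∑ w ∈ G.neighborFinset v, weight W₁ W₂ (crossing x t v w) :=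
    Finset.sum_nonneg fun _ _ => (weight_pos hW₁ hW₂ _).le
  -- Both probabilities share the normalising sum, so only the balance of the unnormalised weights
  -- matters.
  rw [div_mul_eq_mul_div, div_mul_eq_mul_div, ← add_div]
  exact div_nonneg key hZ

theorem adaptedAt_competition (θ : ℝ) (m : ℕ) (v a b : V) {t : ℕ} (hmt : m ≤ t) :
    AdaptedAt t (competition (N := N) W₁ θ m v a b t) := by
  intro x x' h
  have hc : ∀ a b, crossing x t a b = crossing x' t a b := fun a b => adaptedAt_crossing t a b _ _ h
  have hC : Competing m t v a b x ↔ Competing m t v a b x' :=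
    iff_of_eq (adaptedAt_competing hmt v a b _ _ h)
  simp only [competition, hc]
  by_cases hp : Competing m t v a b x
  · rw [if_pos hp, if_pos (hC.mp hp)]
  · rw [if_neg hp, if_neg (fun hp' => hp (hC.mpr hp'))]

end Fixation

end AntRW

namespace AntRW

/-! ### No two outgoing edges compete forever, and every walker keeps moving. -/

section AlmostSure

set_option linter.unusedSectionVars false

variable {V : Type*} [Fintype V] [DecidableEq V] {G : SimpleGraph V} [DecidableRel G.Adj]
  {N : ℕ} {W₁ W₂ : ℕ → ℝ}

/-- From time `m` on the crossing numbers of `(v, a)` and `(v, b)` are positive and do not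
decrease, and both of them are unbounded. -/
def BothDiverge (m : ℕ) (v a b : V) (x : ℕ → Fin N → V) : Prop :=
  (∀ t, m ≤ t → Competing m t v a b x) ∧
    ∀ k : ℕ, (∃ t, m ≤ t ∧ (k : ℤ) ≤ crossing x t v a) ∧ ∃ t, m ≤ t ∧ (k : ℤ) ≤ crossing x t v b

/-- Both tail sums vanish in the limit, and the test function is continuous with value `0` at the
origin. -/
theorem BothDiverge.tendsto_competition {m : ℕ} {v a b : V} {x : ℕ → Fin N → V}
    (h : BothDiverge m v a b x) (θ : ℝ) :
    Tendsto (fun t => competition W₁ θ m v a b t x) atTop (nhds 0) := by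
  have ha : Tendsto (fun t => (crossing x t v a).toNat) atTop atTop := by
    refine tendsto_atTop.mpr fun k => ?_
    obtain ⟨t, ht, hk⟩ := (h.2 k).1
    refine eventually_atTop.mpr ⟨t, fun s hs => ?_⟩
    have := ((h.1 s (by omega)).crossing_le ht hs le_rfl).1
    omega
  have hb : Tendsto (fun t => (crossing x t v b).toNat) atTop atTop := by
    refine tendsto_atTop.mpr fun k => ?_
    obtain ⟨t, ht, hk⟩ := (h.2 k).2
    refine eventually_atTop.mpr ⟨t, fun s hs => ?_⟩
    have := ((h.1 s (by omega)).crossing_le ht hs le_rfl).2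
    omega
  set p : ℕ → ℝ := fun k => (W₁ k)⁻¹
  set q : ℕ → ℝ := fun k => (W₁ k)⁻¹ ^ 2
  have hD : Tendsto (fun t => tail p (crossing x t v a).toNat - tail p (crossing x t v b).toNat)
      atTop (nhds 0) := by
    simpa using ((tendsto_tail p).comp ha).sub ((tendsto_tail p).comp hb)
  have hQ : Tendsto (fun t => tail q (crossing x t v a).toNat + tail q (crossing x t v b).toNat)
      atTop (nhds 0) := by
    simpa using ((tendsto_tail q).comp ha).add ((tendsto_tail q).comp hb)
  have hc : Continuous fun z : ℝ × ℝ => testFun θ z.1 z.2 := by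
    unfold testFun
    fun_prop
  have hlim := (hc.tendsto (0, 0)).comp (hD.prodMk_nhds hQ)
  have h0 : testFun θ 0 0 = 0 := by simp [testFun]
  rw [h0] at hlim
  refine hlim.congr' (eventually_atTop.mpr ⟨m, fun t ht => ?_⟩)
  exact (if_pos (h.1 t ht)).symm

variable [MeasurableSpace V] [MeasurableSingletonClass V] {μ : Measure (ℕ → Fin N → V)}

theorem measurableSet_bothDiverge (m : ℕ) (v a b : V) :
    MeasurableSet {x : ℕ → Fin N → V | BothDiverge m v a b x} := by
  have hge : ∀ (k : ℕ) (c : V),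
      MeasurableSet {x : ℕ → Fin N → V | ∃ t, m ≤ t ∧ (k : ℤ) ≤ crossing x t v c} := by
    intro k c
    have : {x : ℕ → Fin N → V | ∃ t, m ≤ t ∧ (k : ℤ) ≤ crossing x t v c}
        = ⋃ t, ⋃ (_ : m ≤ t), {x | (k : ℤ) ≤ crossing x t v c} := by
      ext; simp
    rw [this]
    refine MeasurableSet.iUnion fun t => MeasurableSet.iUnion fun _ => ?_
    refine AdaptedAt.measurableSet (t := t) fun x x' h => ?_
    have : crossing x t v c = crossing x' t v c := adaptedAt_crossing t v c x x' h
    rw [this]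
  have : {x : ℕ → Fin N → V | BothDiverge m v a b x}
      = (⋂ t, ⋂ (_ : m ≤ t), {x | Competing m t v a b x}) ∩
        ⋂ k : ℕ, {x : ℕ → Fin N → V | ∃ t, m ≤ t ∧ (k : ℤ) ≤ crossing x t v a} ∩
          {x : ℕ → Fin N → V | ∃ t, m ≤ t ∧ (k : ℤ) ≤ crossing x t v b} := by
    ext
    simp [BothDiverge]
  rw [this]
  exact (MeasurableSet.iInter fun t => MeasurableSet.iInter fun ht =>
    (adaptedAt_competing ht v a b).measurableSet).inter
    (MeasurableSet.iInter fun k => (hge k a).inter (hge k b))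

/-- Almost surely no two edges that leave the same vertex compete forever. -/
theorem IsAntLaw.measure_bothDiverge (hμ : IsAntLaw G W₁ W₂ μ) (hN : 1 ≤ N)
    (hW₁ : ∀ k, 0 < W₁ k) (hW₂ : ∀ k, 0 < W₂ k)
    (hsum : Summable fun k => (W₁ k)⁻¹) (hdeg : ∀ v, ∃ u, G.Adj v u)
    {v a b : V} (ha : G.Adj v a) (hb : G.Adj v b) (hab : a ≠ b) (m : ℕ) :
    μ {x | BothDiverge m v a b x} = 0 := by
  have := hμ.prob
  have hN0 : (0 : ℝ) < N := by exact_mod_cast hN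
  set B : Set (ℕ → Fin N → V) := {x | BothDiverge m v a b x}
  have hB : MeasurableSet B := measurableSet_bothDiverge m v a b
  refine measure_eq_zero_of_cyl_bound hB (show (1 - 1 / 19 : ℝ) < 1 by norm_num) m ?_
  intro n hn x
  by_cases hC : Competing m n v a b x
  swap
  · have : B ∩ cyl n x = ∅ := by
      ext z
      simp only [Set.mem_inter_iff, Set.mem_empty_iff_false, iff_false, not_and]
      intro hz hzn
      have e : Competing m n v a b z = Competing m n v a b x :=
        adaptedAt_competing hn v a b _ _ hzn
      exact hC (e ▸ hz.1 n hn)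
    rw [this, measureReal_empty]
    have := measureReal_nonneg (μ := μ) (s := cyl n x)
    positivity
  set p : ℕ → ℝ := fun k => (W₁ k)⁻¹
  set q : ℕ → ℝ := fun k => (W₁ k)⁻¹ ^ 2
  set D := tail p (crossing x n v a).toNat - tail p (crossing x n v b).toNat
  set Q := tail q (crossing x n v a).toNat + tail q (crossing x n v b).toNat with hQdef
  have hq0 : ∀ k, 0 ≤ q k := fun k => sq_nonneg _
  have hQ : 0 < Q := by
    rw [hQdef, tail_eq (summable_sq (fun k => (inv_pos.mpr (hW₁ k)).le) hsum)]
    have h1 := tail_nonneg hq0 ((crossing x n v a).toNat + 1)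
    have h2 := tail_nonneg hq0 (crossing x n v b).toNat
    have h3 : 0 < (W₁ (crossing x n v a).toNat)⁻¹ ^ 2 := pow_pos (inv_pos.mpr (hW₁ _)) 2
    linarith
  set θ := 1 / (19 * (D ^ 2 + Q))
  set Y := competition (N := N) W₁ θ m v a b
  have hstart : 1 / 19 ≤ Y n x := by
    simp only [Y, competition]
    rw [if_pos hC]
    exact le_testFun D hQ
  have hYint : ∀ T, n ≤ T → Integrable (Y T) μ := fun T hT =>
    (adaptedAt_competition θ m v a b (hn.trans hT)).integrable
  -- Off `B` the competition is bounded by `1`. On `B` its positive part is used: it lies in `[0,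
  -- 1]` and tends to `0`, so dominated convergence applies.
  have hbound : ∀ T, n ≤ T → 1 / 19 * μ.real (cyl n x)
      ≤ μ.real (Bᶜ ∩ cyl n x) + ∫ z in cyl n x, B.indicator (fun z => max (Y T z) 0) z ∂μ := by
    intro T hT
    have h1 := hμ.le_integral (g := Y)
      (fun t ht => adaptedAt_competition θ m v a b (hn.trans ht)) hT (fun t ht _ x _ => by
        calc Y t x = ∑ _i : Fin N, (1 / (N : ℝ)) * Y t x := by
              simp
              field_simp
          _ ≤ _ := by
              refine Finset.sum_le_sum fun i _ => ?_
              gcongr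
              exact competition_le_sum hW₁ hW₂ hsum hdeg θ (hn.trans ht) ha hb hab x i) x
    have hi1 : IntegrableOn (Bᶜ.indicator fun _ => (1 : ℝ)) (cyl n x) μ :=
      ((integrable_const (1 : ℝ)).indicator hB.compl).integrableOn
    have hi2 : IntegrableOn (B.indicator fun z => max (Y T z) 0) (cyl n x) μ :=
      (((hYint T hT).sup (integrable_zero _ _ _)).indicator hB).integrableOn
    have h2 : ∫ z in cyl n x, Y T z ∂μ ≤ ∫ z in cyl n x, (Bᶜ.indicator (fun _ => (1 : ℝ)) z
        + B.indicator (fun z => max (Y T z) 0) z) ∂μ := by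
      refine setIntegral_mono (hYint T hT).integrableOn (hi1.add hi2) fun z => ?_
      by_cases hz : z ∈ B
      · simp [hz]
      · simpa [hz] using competition_le_one _ _ _ _ _ _ _
    rw [integral_add hi1 hi2,
      integral_indicator_const _ hB.compl, smul_eq_mul, mul_one,
      measureReal_restrict_apply hB.compl] at h2
    refine le_trans ?_ (h1.trans h2)
    rw [mul_comm]
    exact mul_le_mul_of_nonneg_left hstart measureReal_nonneg
  have hlim : Tendsto (fun T => ∫ z in cyl n x, B.indicator (fun z => max (Y T z) 0) z ∂μ) atTop
      (nhds (∫ z in cyl n x, (0 : ℝ) ∂μ)) := by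
    refine (tendsto_add_atTop_iff_nat n).mp ?_
    refine tendsto_integral_of_dominated_convergence (fun _ => (1 : ℝ)) (fun T => ?_)
      (integrable_const _) (fun T => ae_of_all _ fun z => ?_) (ae_of_all _ fun z => ?_)
    · exact (((hYint (T + n) (by omega)).sup (integrable_zero _ _ _)).indicator
        hB).integrableOn.aestronglyMeasurable
    · by_cases hzB : z ∈ B
      · rw [Set.indicator_of_mem hzB, Real.norm_of_nonneg (le_max_right _ _)]
        exact max_le (competition_le_one _ _ _ _ _ _ _) zero_le_one
      · simp [hzB]
    · refine (tendsto_add_atTop_iff_nat (f := fun T => B.indicator (fun z => max (Y T z) 0) z)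
        n).mpr ?_
      by_cases hzB : z ∈ B
      · simp only [Set.indicator_of_mem hzB]
        have := (BothDiverge.tendsto_competition (W₁ := W₁) hzB θ).max
          (tendsto_const_nhds (x := (0 : ℝ)))
        simpa using this
      · simp [hzB]
  rw [integral_zero] at hlim
  have hfin : 1 / 19 * μ.real (cyl n x) ≤ μ.real (Bᶜ ∩ cyl n x) + 0 :=
    ge_of_tendsto (tendsto_const_nhds.add hlim) (eventually_atTop.mpr ⟨n, hbound⟩)
  have hsplit := measureReal_inter_add_sdiff (μ := μ) (s := cyl n x) hB
  rw [Set.sdiff_eq] at hsplit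
  rw [Set.inter_comm, add_zero] at hfin
  rw [Set.inter_comm]
  linarith

/-- Almost surely every walker moves infinitely often. -/
theorem IsAntLaw.ae_moves (hμ : IsAntLaw G W₁ W₂ μ) (hN : 1 ≤ N)
    (hW₁ : ∀ k, 0 < W₁ k) (hW₂ : ∀ k, 0 < W₂ k) (hdeg : ∀ v, ∃ u, G.Adj v u) :
    ∀ᵐ x ∂μ, ∀ (i : Fin N) (m : ℕ), ∃ t, m ≤ t ∧ x (t + 1) i ≠ x t i := by
  have := hμ.prob
  have hN0 : (0 : ℝ) < N := by exact_mod_cast hN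
  simp only [ae_all_iff]
  intro i m
  have hmove : ∀ t, AdaptedAt (t + 1) fun x : ℕ → Fin N → V => x (t + 1) i ≠ x t i := by
    intro t x x' h
    simp only [h t (by omega), h (t + 1) le_rfl]
  have hB : MeasurableSet {x : ℕ → Fin N → V | ∃ t, m ≤ t ∧ x (t + 1) i ≠ x t i} := by
    have : {x : ℕ → Fin N → V | ∃ t, m ≤ t ∧ x (t + 1) i ≠ x t i}
        = ⋃ t, ⋃ (_ : m ≤ t), {x | x (t + 1) i ≠ x t i} := by
      ext; simp
    rw [this]
    exact MeasurableSet.iUnion fun t => MeasurableSet.iUnion fun _ => (hmove t).measurableSet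
  refine measure_eq_zero_of_cyl_bound hB.compl
    (show 1 - 1 / (N : ℝ) < 1 by have := one_div_pos.mpr hN0; linarith) m ?_
  intro n hn x
  classical
  set E : Set (ℕ → Fin N → V) := {z | z (n + 1) i ≠ z n i}
  -- One step suffices: walker `i` is selected with probability `1 / N`, and a selected walker
  -- always changes position.
  set g : ℕ → (ℕ → Fin N → V) → ℝ := fun t z => if t ≤ n then 1 / (N : ℝ) else
    E.indicator (fun _ => 1) z
  have hga : ∀ t, n ≤ t → AdaptedAt t (g t) := by
    intro t _ z z' h
    by_cases ht : t ≤ n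
    · simp [g, ht]
    · have e : (z ∈ E) = (z' ∈ E) := hmove n z z' fun k hk => h k (by omega)
      simp only [g, if_neg ht, Set.indicator_apply, e]
  have key := hμ.le_integral hga (Nat.le_succ n) (fun t ht htn x _ => by
    obtain rfl : t = n := by omega
    simp only [g, le_refl, if_true, Nat.not_succ_le_self, if_false]
    have hterm : ∀ (j : Fin N) (u : V), 0 ≤ jumpProb G W₁ W₂ x t (x t j) u
        * E.indicator (fun _ => (1 : ℝ)) (jumpTo x t j u) := fun j u =>
      mul_nonneg (jumpProb_nonneg G hW₁ hW₂ _ _ _ _) (Set.indicator_nonneg (fun _ _ => zero_le_one) _)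
    refine le_trans ?_ (Finset.single_le_sum (fun j _ => mul_nonneg (by positivity)
      (Finset.sum_nonneg fun u _ => hterm j u)) (Finset.mem_univ i))
    rw [Finset.sum_congr rfl fun u hu => ?_, sum_jumpProb G hW₁ hW₂ x t (hdeg (x t i)), mul_one]
    rw [Set.indicator_of_mem, mul_one]
    have hu' := ((G.mem_neighborFinset _ _).mp hu).ne'
    simpa [E, jumpTo_succ, jumpTo_of_le x i u le_rfl] using hu') x
  simp only [g, le_refl, if_true, Nat.succ_eq_add_one, Nat.not_succ_le_self, if_false] at key
  have hE : MeasurableSet E := (hmove n).measurableSet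
  rw [integral_indicator_const _ hE, smul_eq_mul, mul_one, measureReal_restrict_apply hE] at key
  have hle : μ.real (E ∩ cyl n x)
      ≤ μ.real (cyl n x ∩ {x : ℕ → Fin N → V | ∃ t, m ≤ t ∧ x (t + 1) i ≠ x t i}) :=
    measureReal_mono fun z hz => ⟨hz.2, n, hn, hz.1⟩
  have hsplit := measureReal_inter_add_sdiff (μ := μ) (s := cyl n x) hB
  rw [Set.sdiff_eq] at hsplit
  rw [Set.inter_comm]
  have : (1 - 1 / (N : ℝ)) * μ.real (cyl n x) = μ.real (cyl n x) - μ.real (cyl n x) * (1 / N) := by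
    ring
  rw [this]
  change μ.real (cyl n x ∩ {x : ℕ → Fin N → V | ∃ t, m ≤ t ∧ x (t + 1) i ≠ x t i}ᶜ) ≤ _
  linarith

end AlmostSure

/-! ### Strong reinforcement from (A2). -/

section Summability

/-- The summability condition forces strong reinforcement if the maximum degree is at least `3`. -/
theorem SummabilityCondition.summable {Δ N : ℕ} {W₁ W₂ : ℕ → ℝ} (hΔ : 3 ≤ Δ) (hN : 1 ≤ N)
    (hW₁ : ∀ k, 0 < W₁ k) (hW₂ : ∀ k, 0 < W₂ k) (h : SummabilityCondition Δ N W₁ W₂) :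
    Summable fun k => (W₁ k)⁻¹ := by
  -- The third coordinate stays at `0` and keeps `W₂ 0` in the numerator, while the denominator is
  -- `W₁ (n + 1)`. The coordinate sum is always `1`, which is allowed because `N ≥ 1`.
  set s : ℕ → Fin 3 → ℤ := fun n => ![1 + n, -n, 0]
  have hs : (⟨3, s⟩ : Σ d : ℕ, ℕ → Fin d → ℤ) ∈ admissible Δ N := by
    refine ⟨⟨by norm_num, hΔ⟩, fun n => ?_, fun n => ⟨0, 1, ?_, ?_, ?_⟩⟩
    · simp [s, Fin.sum_univ_three]
      omega
    · simp [s]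
      omega
    · simp [s]
      omega
    · intro j h0 h1
      fin_cases j
      · exact (h0 rfl).elim
      · exact (h1 rfl).elim
      · simp [s]
  have hfin : ∑' n, ENNReal.ofReal (upsilonNeg W₂ (s n) / upsilonPos W₁ (s n)) ≠ ⊤ :=
    ((le_iSup₂_of_le (⟨3, s⟩ : Σ d : ℕ, ℕ → Fin d → ℤ) hs le_rfl).trans_lt h).ne
  have hpos : ∀ n, upsilonPos W₁ (s n) = W₁ (n + 1) := by
    intro n
    have h1 : (0 : ℤ) < 1 + n := by omega
    have h2 : ((1 : ℤ) + n).toNat = n + 1 := by omega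
    simp [upsilonPos, s, Finset.sum_filter, Fin.sum_univ_three, h1, h2]
  have hneg : ∀ n, W₂ 0 ≤ upsilonNeg W₂ (s n) := by
    intro n
    have : W₂ (-s n 2).toNat = W₂ 0 := by simp [s]
    rw [← this]
    exact Finset.single_le_sum (f := fun i => W₂ (-s n i).toNat) (fun i _ => (hW₂ _).le)
      (by simp [s])
  have hsum : Summable fun n => upsilonNeg W₂ (s n) / upsilonPos W₁ (s n) := by
    refine (ENNReal.summable_toReal hfin).congr fun n => ?_
    refine ENNReal.toReal_ofReal (div_nonneg ((hW₂ 0).le.trans (hneg n)) ?_)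
    rw [hpos]
    exact (hW₁ _).le
  rw [← summable_nat_add_iff 1]
  refine Summable.of_nonneg_of_le (fun n => (inv_pos.mpr (hW₁ _)).le) (fun n => ?_)
    (hsum.mul_left (W₂ 0)⁻¹)
  rw [hpos, ← mul_div_assoc, inv_eq_one_div (W₁ (n + 1))]
  refine div_le_div_of_nonneg_right ?_ (hW₁ _).le
  rw [← inv_mul_cancel₀ (hW₂ 0).ne']
  exact mul_le_mul_of_nonneg_left (hneg n) (inv_pos.mpr (hW₂ 0)).le

end Summability

end AntRW

namespace AntRW

/-! ### Circuits from periodic orbits. -/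

section ClosedWalks

variable {V : Type*} {G : SimpleGraph V}

/-- The walk along a sequence of consecutively adjacent vertices. -/
def seqWalk {a : ℕ → V} (h : ∀ k, G.Adj (a k) (a (k + 1))) : (n : ℕ) → G.Walk (a 0) (a n)
  | 0 => SimpleGraph.Walk.nil
  | n + 1 => (seqWalk h n).concat (h n)

theorem support_seqWalk {a : ℕ → V} (h : ∀ k, G.Adj (a k) (a (k + 1))) (n : ℕ) :
    (seqWalk h n).support = (List.range (n + 1)).map a := by
  induction n with
  | zero => simp [seqWalk]
  | succ n ih =>
    rw [seqWalk, SimpleGraph.Walk.support_concat, ih, List.range_succ (n := n + 1)]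
    simp

theorem edges_seqWalk {a : ℕ → V} (h : ∀ k, G.Adj (a k) (a (k + 1))) (n : ℕ) :
    (seqWalk h n).edges = (List.range n).map fun k => s(a k, a (k + 1)) := by
  induction n with
  | zero => simp [seqWalk]
  | succ n ih =>
    rw [seqWalk, SimpleGraph.Walk.edges_concat, ih, List.range_succ]
    simp

/-- A periodic orbit of a map along the edges of a graph that never turns back is a circuit. -/
theorem exists_isCycle_of_orbit {s : V → V} {v : V} (hv : v ∈ Function.periodicPts s)
    (hadj : ∀ k, G.Adj (s^[k] v) (s^[k + 1] v)) (hturn : s (s v) ≠ v) :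
    ∃ (b : V) (C : G.Walk b b), C.IsCycle ∧ (∀ w, w ∈ C.support ↔ ∃ k, s^[k] v = w) ∧
      ∀ e, e ∈ C.edges ↔ ∃ k, s(s^[k] v, s^[k + 1] v) = e := by
  obtain ⟨n, hn⟩ : ∃ n, Function.minimalPeriod s v = n + 1 :=
    Nat.exists_eq_succ_of_ne_zero (Function.minimalPeriod_pos_of_mem_periodicPts hv).ne'
  have hper : s^[n + 1] v = v := hn ▸ Function.iterate_minimalPeriod
  have hmod : ∀ k, s^[k % (n + 1)] v = s^[k] v := fun k => hn ▸ Function.iterate_mod_minimalPeriod_eq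
  have hinj : ∀ i < n + 1, ∀ j < n + 1, s^[i] v = s^[j] v → i = j := by
    intro i hi j hj hij
    exact Function.iterate_injOn_Iio_minimalPeriod (by rwa [hn]) (by rwa [hn]) hij
  -- Period `1` would give a loop and period `2` a turn back, so the orbit has at least three
  -- vertices.
  have hn1 : n ≠ 0 := by
    rintro rfl
    have := (hadj 0).ne
    exact this (by simpa using hper.symm)
  have hn2 : n ≠ 1 := by
    rintro rfl
    exact hturn hper
  set a : ℕ → V := fun k => s^[k] v with ha
  have hclose : G.Adj (a n) (a 0) := by
    have := hadj n
    rwa [hper] at this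
  refine ⟨a n, SimpleGraph.Walk.cons hclose (seqWalk hadj n), ?_, fun w => ?_, fun e => ?_⟩
  · rw [SimpleGraph.Walk.cons_isCycle_iff, SimpleGraph.Walk.isPath_def, support_seqWalk,
      edges_seqWalk]
    constructor
    · refine List.Nodup.map_on (fun i hi j hj => ?_) List.nodup_range
      exact hinj i (List.mem_range.mp hi) j (List.mem_range.mp hj)
    · intro h
      obtain ⟨k, hk, hke⟩ := List.mem_map.mp h
      rw [List.mem_range] at hk
      rcases Sym2.eq_iff.mp hke with ⟨h1, -⟩ | ⟨h1, h2⟩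
      · have := hinj k (by omega) n (by omega) h1
        omega
      · have := hinj k (by omega) 0 (by omega) h1
        have := hinj (k + 1) (by omega) n (by omega) h2
        omega
  · rw [SimpleGraph.Walk.support_cons, support_seqWalk]
    constructor
    · intro h
      rcases List.mem_cons.mp h with rfl | h
      · exact ⟨n, rfl⟩
      · obtain ⟨k, -, hk⟩ := List.mem_map.mp h
        exact ⟨k, hk⟩
    · rintro ⟨k, rfl⟩
      refine List.mem_cons_of_mem _ (List.mem_map.mpr ⟨k % (n + 1), ?_, hmod k⟩)
      exact List.mem_range.mpr (Nat.mod_lt _ n.succ_pos)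
  · rw [SimpleGraph.Walk.edges_cons, edges_seqWalk]
    constructor
    · intro h
      rcases List.mem_cons.mp h with rfl | h
      · exact ⟨n, by rw [hper]; rfl⟩
      · obtain ⟨k, -, hk⟩ := List.mem_map.mp h
        exact ⟨k, hk⟩
    · rintro ⟨k, rfl⟩
      have hk : s^[k + 1] v = s^[k % (n + 1) + 1] v := by
        rw [Function.iterate_succ_apply', Function.iterate_succ_apply', hmod]
      have hlt : k % (n + 1) < n + 1 := Nat.mod_lt k n.succ_pos
      rw [hk, ← hmod k]
      by_cases hkn : k % (n + 1) = n
      · rw [hkn, hper]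
        exact List.mem_cons_self
      · refine List.mem_cons_of_mem _ (List.mem_map.mpr ⟨k % (n + 1), ?_, rfl⟩)
        rw [List.mem_range]
        omega

end ClosedWalks

/-! ### Deterministic trapping in disjoint circuits. -/

section Trapping

variable {V : Type*} [DecidableEq V] {G : SimpleGraph V} {N : ℕ} {x : ℕ → Fin N → V} {m : ℕ}

theorem crossing_mono_of_eventually_good (hg : ∀ t, m ≤ t → IsGoodJump G x t) (u v : V) {r t : ℕ}
    (hr : m ≤ r) (hrt : r ≤ t) :
    (0 < crossing x r u v → crossing x r u v ≤ crossing x t u v) ∧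
      (crossing x r u v ≤ 0 → crossing x t u v ≤ crossing x r u v) := by
  induction t, hrt using Nat.le_induction with
  | base => exact ⟨fun _ => le_rfl, fun _ => le_rfl⟩
  | succ t hrt ih =>
    obtain ⟨i, w, -, hc, hx⟩ := hg t (hr.trans hrt)
    have := crossing_mono_of_good hx hc u v
    constructor <;> intro h <;> omega

theorem monot_of_eventually_good (hg : ∀ t, m ≤ t → IsGoodJump G x t) : Monot G x := by
  refine ⟨m, fun u v _ => ?_⟩
  by_cases h : 0 < crossing x m u v
  · refine Or.inl fun r hr t _ hrt => ?_
    have h1 := (crossing_mono_of_eventually_good hg u v le_rfl hr).1 h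
    exact (crossing_mono_of_eventually_good hg u v hr hrt).1 (h.trans_le h1)
  · refine Or.inr fun r hr t _ hrt => ?_
    have h1 := (crossing_mono_of_eventually_good hg u v le_rfl hr).2 (not_lt.mp h)
    exact (crossing_mono_of_eventually_good hg u v hr hrt).2 (h1.trans (not_lt.mp h))

/-- Some walker jumps from `v` to `u` at time `t`. -/
def JumpsAt (x : ℕ → Fin N → V) (v u : V) (t : ℕ) : Prop :=
  v ≠ u ∧ ∃ i, x t i = v ∧ x (t + 1) i = u

theorem IsGoodJump.of_jumpsAt {t : ℕ} (hg : IsGoodJump G x t) {v u : V} (h : JumpsAt x v u t) :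
    G.Adj v u ∧ 0 < crossing x t v u ∧ crossing x (t + 1) v u = crossing x t v u + 1 := by
  obtain ⟨hvu, i, rfl, rfl⟩ := h
  obtain ⟨j, w, hw, hc, hx⟩ := hg
  have hij : i = j := by
    by_contra hij
    exact hvu (by rw [hx, Function.update_of_ne hij])
  subst hij
  have hxw : x (t + 1) i = w := by rw [hx, Function.update_self]
  rw [hxw]
  refine ⟨hw, hc, ?_⟩
  rw [crossing_succ hx, if_pos ⟨rfl, rfl⟩, if_neg (fun h => hw.ne h.1)]
  omega

theorem pos_of_frequently_jumpsAt (hg : ∀ t, m ≤ t → IsGoodJump G x t) {v u : V}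
    (h : ∃ᶠ t in atTop, JumpsAt x v u t) :
    G.Adj v u ∧ ∃ r, m ≤ r ∧ ∀ t, r ≤ t → 0 < crossing x t v u := by
  obtain ⟨r, hr, hj⟩ := frequently_atTop.mp h m
  obtain ⟨hadj, hc, -⟩ := (hg r hr).of_jumpsAt hj
  exact ⟨hadj, r, hr, fun t ht =>
    hc.trans_le ((crossing_mono_of_eventually_good hg v u hr ht).1 hc)⟩

theorem unbounded_of_frequently_jumpsAt (hg : ∀ t, m ≤ t → IsGoodJump G x t) {v u : V}
    (h : ∃ᶠ t in atTop, JumpsAt x v u t) (r k : ℕ) :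
    ∃ t, r ≤ t ∧ (k : ℤ) ≤ crossing x t v u := by
  obtain ⟨-, r', hr', hpos⟩ := pos_of_frequently_jumpsAt hg h
  suffices hs : ∃ t, max r r' ≤ t ∧ (k : ℤ) ≤ crossing x t v u from
    let ⟨t, ht, hk⟩ := hs
    ⟨t, (le_max_left _ _).trans ht, hk⟩
  induction k with
  | zero => exact ⟨max r r', le_rfl, (hpos _ (le_max_right _ _)).le⟩
  | succ k ih =>
    obtain ⟨t, ht, hk⟩ := ih
    obtain ⟨t', ht', hj⟩ := frequently_atTop.mp h t
    refine ⟨t' + 1, by omega, ?_⟩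
    have h1 := ((hg t' (by omega)).of_jumpsAt hj).2.2
    have h2 := (crossing_mono_of_eventually_good hg v u (by omega) ht').1 (hpos t (by omega))
    push_cast
    omega

theorem bothDiverge_of_frequently_jumpsAt (hg : ∀ t, m ≤ t → IsGoodJump G x t) {v a b : V}
    (ha : ∃ᶠ t in atTop, JumpsAt x v a t) (hb : ∃ᶠ t in atTop, JumpsAt x v b t) :
    ∃ r, BothDiverge r v a b x := by
  obtain ⟨-, r, hr, hra⟩ := pos_of_frequently_jumpsAt hg ha
  obtain ⟨-, r', hr', hrb⟩ := pos_of_frequently_jumpsAt hg hb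
  refine ⟨max r r', fun t _ => ⟨⟨hra _ (le_max_left _ _), hrb _ (le_max_right _ _)⟩,
    fun s hs _ => ⟨?_, ?_⟩⟩, fun k => ⟨unbounded_of_frequently_jumpsAt hg ha _ k,
    unbounded_of_frequently_jumpsAt hg hb _ k⟩⟩
  · exact (crossing_mono_of_eventually_good hg v a (by omega) (Nat.le_succ s)).1
      (hra s ((le_max_left _ _).trans hs))
  · exact (crossing_mono_of_eventually_good hg v b (by omega) (Nat.le_succ s)).1
      (hrb s ((le_max_right _ _).trans hs))

theorem frequently_exists_iff {α ι : Type*} [Finite ι] {l : Filter α} {p : ι → α → Prop} :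
    (∃ᶠ t in l, ∃ i, p i t) ↔ ∃ i, ∃ᶠ t in l, p i t := by
  simp only [Filter.Frequently, not_exists, eventually_all, not_forall]

variable [Fintype V]

/-- Some walker visits `v` infinitely often, and its first move after each visit starts at `v`; with
finitely many targets, one recurs. -/
theorem exists_frequently_jumpsAt (hmove : ∀ (i : Fin N) (r : ℕ), ∃ t, r ≤ t ∧ x (t + 1) i ≠ x t i)
    {v : V} (hv : v ∈ vertexInf x) : ∃ u, ∃ᶠ t in atTop, JumpsAt x v u t := by
  obtain ⟨i, hi⟩ := frequently_exists_iff.mp hv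
  rw [← frequently_exists_iff, frequently_atTop]
  intro r
  obtain ⟨t, ht, hti⟩ := frequently_atTop.mp hi r
  have hex : ∃ k, x (t + k + 1) i ≠ x (t + k) i := by
    obtain ⟨t', ht', h⟩ := hmove i t
    obtain ⟨k, rfl⟩ := Nat.exists_eq_add_of_le ht'
    exact ⟨k, h⟩
  classical
  have hstay : ∀ k ≤ Nat.find hex, x (t + k) i = v := by
    intro k
    induction k with
    | zero => exact fun _ => hti
    | succ k ih =>
      intro hk
      rw [← ih (by omega)]
      exact not_not.mp (Nat.find_min hex (by omega))
  have h1 := hstay _ le_rfl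
  have h2 := Nat.find_spec hex
  refine ⟨t + Nat.find hex, by omega, x (t + Nat.find hex + 1) i, ?_, i, h1, rfl⟩
  rw [← h1]
  exact h2.symm

/-- If all jumps from some time on have positive crossing number, every walker moves infinitely often
and no two edges leaving the same vertex compete forever, then the walkers are trapped in disjoint
circuits. -/
theorem locTrapp_of_eventually_good (hg : ∀ t, m ≤ t → IsGoodJump G x t)
    (hmove : ∀ (i : Fin N) (r : ℕ), ∃ t, r ≤ t ∧ x (t + 1) i ≠ x t i)
    (hcomp : ∀ v a b, G.Adj v a → G.Adj v b → a ≠ b → ∀ r, ¬ BothDiverge r v a b x) :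
    LocTrapp G x := by
  classical
  have huniq : ∀ v a b, (∃ᶠ t in atTop, JumpsAt x v a t) → (∃ᶠ t in atTop, JumpsAt x v b t) →
      a = b := by
    intro v a b ha hb
    by_contra hab
    obtain ⟨r, hr⟩ := bothDiverge_of_frequently_jumpsAt hg ha hb
    exact hcomp v a b (pos_of_frequently_jumpsAt hg ha).1 (pos_of_frequently_jumpsAt hg hb).1 hab r hr
  have hex : ∀ v, ∃ u, v ∈ vertexInf x → ∃ᶠ t in atTop, JumpsAt x v u t := by
    intro v
    by_cases hv : v ∈ vertexInf x
    · obtain ⟨u, hu⟩ := exists_frequently_jumpsAt hmove hv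
      exact ⟨u, fun _ => hu⟩
    · exact ⟨v, fun h => (hv h).elim⟩
  choose s hs using hex
  have hsI : ∀ v ∈ vertexInf x, s v ∈ vertexInf x := by
    intro v hv
    refine frequently_atTop.mpr fun r => ?_
    obtain ⟨t, ht, -, i, -, hi⟩ := frequently_atTop.mp (hs v hv) r
    exact ⟨t + 1, by omega, i, hi⟩
  have hsadj : ∀ v ∈ vertexInf x, G.Adj v (s v) := fun v hv =>
    (pos_of_frequently_jumpsAt hg (hs v hv)).1
  -- A turn back would make the crossing numbers of both orientations of one edge eventually
  -- positive, against antisymmetry.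
  have hturn : ∀ v ∈ vertexInf x, s (s v) ≠ v := by
    intro v hv h
    obtain ⟨-, r, -, hr⟩ := pos_of_frequently_jumpsAt hg (hs v hv)
    obtain ⟨-, r', -, hr'⟩ := pos_of_frequently_jumpsAt hg (hs (s v) (hsI v hv))
    have h1 := hr (max r r') (le_max_left _ _)
    have h2 := hr' (max r r') (le_max_right _ _)
    rw [h, crossing_antisymm] at h2
    omega
  -- After `T` only recurrent vertices and recurrent jumps occur, so every move follows the
  -- successor map `s`.
  obtain ⟨T, hT⟩ : ∃ T, ∀ t, T ≤ t → (∀ v, v ∉ vertexInf x → ∀ i, x t i ≠ v) ∧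
      ∀ v u, (¬ ∃ᶠ t in atTop, JumpsAt x v u t) → ¬ JumpsAt x v u t := by
    refine eventually_atTop.mp (Filter.Eventually.and ?_ ?_)
    · refine eventually_all.mpr fun v => ?_
      by_cases hv : v ∈ vertexInf x
      · exact Eventually.of_forall fun t h => (h hv).elim
      · have := not_frequently.mp hv
        filter_upwards [this] with t ht _ i hi
        exact ht ⟨i, hi⟩
    · refine eventually_all.mpr fun v => eventually_all.mpr fun u => ?_
      by_cases hvu : ∃ᶠ t in atTop, JumpsAt x v u t
      · exact Eventually.of_forall fun t h => (h hvu).elim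
      · filter_upwards [not_frequently.mp hvu] with t ht _ using ht
  have hpos : ∀ t, T ≤ t → ∀ i, x t i ∈ vertexInf x := by
    intro t ht i
    by_contra h
    exact (hT t ht).1 _ h i rfl
  have hstep : ∀ t, T ≤ t → ∀ i, x (t + 1) i ≠ x t i → x (t + 1) i = s (x t i) := by
    intro t ht i hi
    have hj : JumpsAt x (x t i) (x (t + 1) i) t := ⟨hi.symm, i, rfl, rfl⟩
    refine huniq (x t i) _ _ ?_ (hs _ (hpos t ht i))
    by_contra h
    exact (hT t ht).2 _ _ h hj
  have hreach : ∀ t, T ≤ t → ∀ i, ∀ r, t ≤ r → ∃ k, s^[k] (x t i) = x r i := by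
    intro t ht i r hr
    induction r, hr using Nat.le_induction with
    | base => exact ⟨0, rfl⟩
    | succ r hr ih =>
      obtain ⟨k, hk⟩ := ih
      by_cases hi : x (r + 1) i = x r i
      · exact ⟨k, hk.trans hi.symm⟩
      · refine ⟨k + 1, ?_⟩
        rw [Function.iterate_succ_apply', hk, hstep r (ht.trans hr) i hi]
  -- A walker that visits `v` infinitely often moves between two suitable visits, so a positive
  -- number of iterates of `s` brings `v` back to itself.
  have hper : ∀ v ∈ vertexInf x, v ∈ Function.periodicPts s := by
    intro v hv
    obtain ⟨i, hi⟩ := frequently_exists_iff.mp hv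
    obtain ⟨t, ht, hti⟩ := frequently_atTop.mp hi T
    obtain ⟨r, hr, hri⟩ := hmove i t
    obtain ⟨k₁, hk₁⟩ := hreach t ht i r hr
    obtain ⟨t', ht', hti'⟩ := frequently_atTop.mp hi (r + 1)
    obtain ⟨k₂, hk₂⟩ := hreach (r + 1) (by omega) i t' ht'
    refine ⟨k₂ + 1 + k₁, by omega, ?_⟩
    rw [Function.IsPeriodicPt, Function.IsFixedPt]
    rw [hstep r (by omega) i hri, ← hk₁, hti', hti, ← Function.iterate_succ_apply' s,
      ← Function.iterate_add_apply] at hk₂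
    rwa [show k₂ + 1 + k₁ = k₂ + k₁.succ by omega]
  have hiter : ∀ v ∈ vertexInf x, ∀ k, s^[k] v ∈ vertexInf x := by
    intro v hv k
    induction k with
    | zero => exact hv
    | succ k ih =>
      rw [Function.iterate_succ_apply']
      exact hsI _ ih
  set O : V → Set V := fun v => {w | ∃ k, s^[k] v = w} with hO
  have hOeq : ∀ v ∈ vertexInf x, ∀ w ∈ O v, O w = O v := by
    rintro v hv w ⟨k, rfl⟩
    ext z
    constructor
    · rintro ⟨l, rfl⟩
      exact ⟨l + k, Function.iterate_add_apply _ _ _ _⟩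
    · rintro ⟨l, rfl⟩
      obtain ⟨n, hn, hvn⟩ := hper v hv
      refine ⟨l + (n - 1) * k, ?_⟩
      have h1 : s^[n * k] v = v := hvn.mul_const k
      have h2 : (n - 1) * k + k = n * k := by
        rw [← Nat.succ_mul]
        congr 1
        omega
      rw [Function.iterate_add_apply, ← Function.iterate_add_apply s ((n - 1) * k), h2, h1]
  -- Every recurrent vertex is later reached by a walker that stays in the orbit of its position at
  -- time `T`, so there are at most `N` orbits.
  set 𝒪 : Finset (Set V) := Finset.univ.image fun i => O (x T i)
  have hcard : 𝒪.card ≤ N := by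
    simpa using Finset.card_image_le (s := (Finset.univ : Finset (Fin N))) (f := fun i => O (x T i))
  have hmem : ∀ v ∈ vertexInf x, O v ∈ 𝒪 := by
    intro v hv
    obtain ⟨t, ht, i, hti⟩ := frequently_atTop.mp hv T
    obtain ⟨k, hk⟩ := hreach T le_rfl i t ht
    refine Finset.mem_image.mpr ⟨i, Finset.mem_univ _, (hOeq _ (hpos T le_rfl i) v ?_).symm⟩
    exact ⟨k, hk.trans hti⟩
  have hcyc : ∀ o : 𝒪, ∃ (b : V) (C : G.Walk b b), C.IsCycle ∧ (∀ w, w ∈ C.support ↔ w ∈ o.1) ∧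
      ∀ e, e ∈ C.edges ↔ ∃ w ∈ o.1, s(w, s w) = e := by
    rintro ⟨o, ho⟩
    obtain ⟨i, -, rfl⟩ := Finset.mem_image.mp ho
    have hv := hpos T le_rfl i
    obtain ⟨b, C, h1, h2, h3⟩ := exists_isCycle_of_orbit (G := G) (hper _ hv) (fun k => by
      rw [Function.iterate_succ_apply']
      exact hsadj _ (hiter _ hv k)) (hturn _ hv)
    refine ⟨b, C, h1, h2, fun e => (h3 e).trans ?_⟩
    constructor
    · rintro ⟨k, rfl⟩
      exact ⟨_, ⟨k, rfl⟩, by rw [Function.iterate_succ_apply']⟩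
    · rintro ⟨_, ⟨k, rfl⟩, rfl⟩
      exact ⟨k, by rw [Function.iterate_succ_apply']⟩
  choose b C hC hsupp hedges using hcyc
  have hsub : ∀ o : 𝒪, ∀ w ∈ o.1, w ∈ vertexInf x ∧ O w = o.1 := by
    rintro ⟨o, ho⟩ w hw
    obtain ⟨i, -, rfl⟩ := Finset.mem_image.mp ho
    obtain ⟨k, rfl⟩ := hw
    exact ⟨hiter _ (hpos T le_rfl i) k, hOeq _ (hpos T le_rfl i) _ ⟨k, rfl⟩⟩
  set e := 𝒪.equivFin.symm
  refine ⟨monot_of_eventually_good hg, 𝒪.card, hcard, fun k => b (e k), fun k => C (e k),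
    fun k => hC _, fun k l hkl => ?_, ?_, ?_⟩
  · refine Set.disjoint_left.mpr fun w hk hl => hkl (e.injective (Subtype.ext ?_))
    have h1 := (hsub (e k) w ((hsupp _ w).mp hk)).2
    have h2 := (hsub (e l) w ((hsupp _ w).mp hl)).2
    exact h1.symm.trans h2
  · ext v
    rw [Set.mem_iUnion]
    constructor
    · intro hv
      refine ⟨e.symm ⟨O v, hmem v hv⟩, (hsupp _ v).mpr ?_⟩
      rw [Equiv.apply_symm_apply]
      exact ⟨0, rfl⟩
    · rintro ⟨k, hk⟩
      exact (hsub _ v ((hsupp _ v).mp hk)).1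
  · ext d
    rw [Set.mem_iUnion]
    constructor
    · rintro ⟨hd, hfreq⟩
      obtain ⟨t, ht, i, hi⟩ := frequently_atTop.mp hfreq T
      have hne : x (t + 1) i ≠ x t i := by
        intro h
        rw [← hi, h] at hd
        exact G.irrefl hd
      have hv := hpos t ht i
      refine ⟨e.symm ⟨O (x t i), hmem _ hv⟩, (hedges _ d).mpr ⟨x t i, ?_, ?_⟩⟩
      · rw [Equiv.apply_symm_apply]
        exact ⟨0, rfl⟩
      · rw [← hstep t ht i hne, hi]
    · rintro ⟨k, hk⟩
      obtain ⟨w, hw, rfl⟩ := (hedges _ d).mp hk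
      have hwI := (hsub _ w hw).1
      refine ⟨hsadj w hwI, (hs w hwI).mono fun t ht => ?_⟩
      obtain ⟨-, i, h1, h2⟩ := ht
      exact ⟨i, by rw [h1, h2]⟩

/-- At a vertex of degree at most two, two outgoing edges cannot compete forever. -/
theorem not_bothDiverge_of_maxDegree_le [DecidableRel G.Adj] (hdeg : G.maxDegree ≤ 2)
    (hx : ∀ t, IsJump G x t) {v a b : V} (ha : G.Adj v a) (hb : G.Adj v b) (hab : a ≠ b) (r : ℕ) :
    ¬ BothDiverge r v a b x := by
  intro h
  have hnb : ({a, b} : Finset V) = G.neighborFinset v := by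
    refine Finset.eq_of_subset_of_card_le ?_ ?_
    · intro w hw
      rw [G.mem_neighborFinset]
      rcases Finset.mem_insert.mp hw with rfl | hw
      · exact ha
      · exact Finset.mem_singleton.mp hw ▸ hb
    · rw [Finset.card_pair hab]
      exact (G.degree_le_maxDegree v).trans hdeg
  -- With `a` and `b` the only neighbours, a crossing number of at least `N + 1` next to a positive
  -- one violates the bound `N` on their sum.
  obtain ⟨t, ht, hk⟩ := (h.2 (N + 1)).1
  have h1 := (abs_sum_crossing_le G (fun m (_ : m < t) => hx m) v).2
  rw [← hnb, Finset.sum_pair hab] at h1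
  have h2 := ((h.1 t ht).crossing_le le_rfl ht le_rfl).2
  have h3 := (h.1 t ht).1.2
  push_cast at hk
  omega

end Trapping

end AntRW

namespace AntRW

/-! ### From the process to its law on trajectories. -/

section Transfer

variable {V : Type*} [Fintype V] [DecidableEq V] {G : SimpleGraph V} [DecidableRel G.Adj]
  {N : ℕ} {W₁ W₂ : ℕ → ℝ} {Ω : Type*} [MeasurableSpace Ω] {P : Measure Ω}
  {X : ℕ → Ω → Fin N → V} [MeasurableSpace V] [MeasurableSingletonClass V]

theorem IsAntRW.measurable_trajectory (hX : IsAntRW G W₁ W₂ P X) :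
    Measurable fun ω n => X n ω :=
  measurable_pi_lambda _ fun n => measurable_to_countable' fun y => hX.measurableSet_eq n y

theorem IsAntRW.isAntLaw [IsProbabilityMeasure P] (hX : IsAntRW G W₁ W₂ P X) :
    IsAntLaw G W₁ W₂ (P.map fun ω n => X n ω) where
  prob := Measure.isProbabilityMeasure_map hX.measurable_trajectory.aemeasurable
  transition n x := by
    rw [map_measureReal_apply hX.measurable_trajectory (measurableSet_cyl _ _),
      map_measureReal_apply hX.measurable_trajectory (measurableSet_cyl _ _)]
    exact hX.transition n x

end Transfer

end AntRW

theorem theorem4p2 {V : Type*} [Fintype V] [DecidableEq V] (G : SimpleGraph V)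
    [DecidableRel G.Adj] (hconn : G.Connected) (hcircuit : ¬ G.IsAcyclic)
    (N : ℕ) (hN : 1 ≤ N)
    (W₁ W₂ : ℕ → ℝ) (hW₁ : ∀ k, 0 < W₁ k) (hW₂ : ∀ k, 0 < W₂ k)
    (hA2 : AntRW.SummabilityCondition G.maxDegree N W₁ W₂)
    {Ω : Type*} [MeasurableSpace Ω] (P : Measure Ω) [IsProbabilityMeasure P]
    (X : ℕ → Ω → Fin N → V) (hX : AntRW.IsAntRW G W₁ W₂ P X) :
    (∀ᵐ ω ∂P, AntRW.Monot G (fun n => X n ω)) ∧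
    (3 ≤ G.maxDegree → Summable (fun k => (W₁ k)⁻¹)) ∧
    (∀ᵐ ω ∂P, AntRW.LocTrapp G (fun n => X n ω)) := by
  have hsum : 3 ≤ G.maxDegree → Summable (fun k => (W₁ k)⁻¹) := fun h => hA2.summable h hN hW₁ hW₂
  have htrapp : ∀ᵐ ω ∂P, AntRW.LocTrapp G (fun n => X n ω) := by
    -- The discrete σ-algebra lets the walk be studied through its law on path space.
    let _ : MeasurableSpace V := ⊤
    have hμ := hX.isAntLaw
    obtain ⟨f, hf, -⟩ := AntRW.exists_escape hconn hcircuit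
    have hdeg : ∀ v, ∃ u, G.Adj v u := fun v => ⟨f v, hf v⟩
    have hjump := hμ.ae_isJump
    have hcomp : ∀ᵐ x ∂(P.map fun ω n => X n ω), ∀ v a b, G.Adj v a → G.Adj v b → a ≠ b →
        ∀ r, ¬ AntRW.BothDiverge r v a b x := by
      rcases le_or_gt 3 G.maxDegree with h | h
      · simp only [ae_all_iff]
        intro v a b ha hb hab r
        rw [ae_iff]
        simpa using hμ.measure_bothDiverge hN hW₁ hW₂ (hsum h) hdeg ha hb hab r
      · filter_upwards [hjump] with x hx v a b ha hb hab r
        exact AntRW.not_bothDiverge_of_maxDegree_le (by omega) hx ha hb hab r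
    refine ae_of_ae_map hX.measurable_trajectory.aemeasurable ?_
    filter_upwards [hcomp, hμ.ae_moves hN hW₁ hW₂ hdeg,
      hμ.ae_eventually_isGoodJump hconn hcircuit hN hW₁ hW₂ hA2] with x h1 h2 ⟨m, h3⟩
    exact AntRW.locTrapp_of_eventually_good h3 h2 h1
  exact ⟨htrapp.mono fun _ h => h.1, hsum, htrapp⟩
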